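/- Let $\mathcal{Y}$ be a finite set of outcomes, $\Theta$ an arbitrary set, and let $(x_1,y_1),(x_2,y_2),\dots$ be i.i.d. random pairs with law $\mathbb{P}$, where $y_i\in\mathcal{Y}$ and $x_i\in\mathcal{X}$. For every $\theta\in\Theta$ let $f_\theta(\cdot\mid x)$, $x\in\mathcal{X}$, be a probability mass function on $\mathcal{Y}$ (measurable in $x$). For two mass functions or densities $p,q$ on $\mathcal{X}\times\mathcal{Y}$ write $\mathrm{TVD}(p,q)=\frac12\sum_{y}\sum_{x}|p(x,y)-q(x,y)|$ if $\mathcal{X}$ is finite, and $\mathrm{TVD}(p,q)=\frac12\sum_{y}\int_{\mathcal{X}}|p(x,y)-q(x,y)|\,dx$ if $\mathcal{X}\subseteq\mathbb{R}^d$. (1) Suppose that $\mathcal{X}$ is finite. Let $p$ and $p^x$ be the joint and the covariate mass functions of $\mathbb{P}$, and put $p_\theta(x,y)=f_\theta(y\mid x)\,p^x(x)$; let $\hat p_n$ and $\hat p_n^x$ be the empirical joint and covariate mass functions of the first $n$ observations, and put $\hat p_{\theta,n}(x,y)=f_\theta(y\mid x)\,\hat p_n^x(x)$. Then for every $\theta\in\Theta$,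 almost surely, $\mathrm{TVD}(\hat p_n,\hat p_{\theta,n})\to\mathrm{TVD}(p,p_\theta)$ as $n\to\infty$. (2) Suppose that $\mathcal{X}\subseteq\mathbb{R}^d$ is Borel and that the law of $x_1$ is absolutely continuous with respect to Lebesgue measure, with density $p^x$; let $p(x,y)$ be the joint density of $\mathbb{P}$ with respect to the product of Lebesgue and counting measure, and put $p_\theta(x,y)=f_\theta(y\mid x)\,p^x(x)$. Let $K:\mathbb{R}^d\to\mathbb{R}$ be integrable with $\int_{\mathbb{R}^d} K(u)\,du=1$, and let $h_n>0$ satisfy $h_n\to0$ and $n h_n^d\to\infty$. Put $$\hat p_n^{h_n}(x,y)=\frac1n\sum_{i=1}^n \mathbf 1\{y_i=y\}\,\frac{1}{h_n^d}K\Big(\frac{x_i-x}{h_n}\Big),\quad \hat p_n^{x,h_n}(x)=\sum_{y\in\mathcal{Y}}\hat p_n^{h_n}(x,y),\quad \hat p_{\theta,n,h_n}(x,y)=f_\theta(y\mid x)\,\hat p_n^{x,h_n}(x),$$ and let $n_y$ be the number of $i\le n$ with $y_i=y$. Then for every $\theta\in\Theta$, almost surely, $\mathrm{TVD}(\hat p_n^{h_n},\hat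 p_{\theta,n,h_n})\to\mathrm{TVD}(p,p_\theta)$ as $\min_{y\in\mathcal{Y}} n_y\to\infty$; that is, almost surely, for every $\varepsilon>0$ there is an $N$ such that $|\mathrm{TVD}(\hat p_n^{h_n},\hat p_{\theta,n,h_n})-\mathrm{TVD}(p,p_\theta)|<\varepsilon$ for all $n$ with $\min_y n_y\ge N$. -/

import Mathlib

open MeasureTheory ProbabilityTheory Filter Topology

noncomputable section

/-- Conditional probability mass functions `f x y = f(y | x)` on the finite set `𝒴`, for the
covariates `x` in `X`. -/
structure IsCondPMFOn {𝒳 𝒴 : Type*} [Fintype 𝒴] (X : Set 𝒳) (f : 𝒳 → 𝒴 → ℝ) : Prop where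
  nonneg : ∀ x ∈ X, ∀ y, 0 ≤ f x y
  sum_eq_one : ∀ x ∈ X, ∑ y, f x y = 1

/-- The joint mass function or density `f(y | x) q(x)` built from a conditional `f` and a marginal
mass function or density `q` of the covariate. -/
def hybridJoint {𝒳 𝒴 : Type*} (f : 𝒳 → 𝒴 → ℝ) (q : 𝒳 → ℝ) (x : 𝒳) (y : 𝒴) : ℝ :=
  f x y * q x

/-! ### Finite covariate space -/

/-- Total variation distance of two mass functions on a finite product. -/
def tvdFinite {𝒳 𝒴 : Type*} [Fintype 𝒳] [Fintype 𝒴] (p q : 𝒳 → 𝒴 → ℝ) : ℝ :=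
  (1 / 2) * ∑ x, ∑ y, |p x y - q x y|

/-- Joint mass function of a law on `𝒳 × 𝒴`. -/
def massJoint {𝒳 𝒴 : Type*} [MeasurableSpace 𝒳] [MeasurableSpace 𝒴]
    (P : Measure (𝒳 × 𝒴)) (x : 𝒳) (y : 𝒴) : ℝ :=
  P.real {(x, y)}

/-- Mass function of the covariate under a law on `𝒳 × 𝒴`. -/
def massMarginal {𝒳 𝒴 : Type*} [MeasurableSpace 𝒳] [MeasurableSpace 𝒴]
    (P : Measure (𝒳 × 𝒴)) (x : 𝒳) : ℝ :=
  (P.map Prod.fst).real {x}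

/-- Joint empirical mass function of the first `n` observations. -/
def empJoint {𝒳 𝒴 : Type*} [DecidableEq 𝒳] [DecidableEq 𝒴]
    (z : ℕ → 𝒳 × 𝒴) (n : ℕ) (x : 𝒳) (y : 𝒴) : ℝ :=
  (1 / (n : ℝ)) * ∑ i ∈ Finset.range n, if z i = (x, y) then 1 else 0

/-- Empirical mass function of the covariates of the first `n` observations. -/
def empMarginal {𝒳 𝒴 : Type*} [DecidableEq 𝒳]
    (z : ℕ → 𝒳 × 𝒴) (n : ℕ) (x : 𝒳) : ℝ :=
  (1 / (n : ℝ)) * ∑ i ∈ Finset.range n, if (z i).1 = x then 1 else 0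

/-! ### Covariates in `ℝ^d` -/

/-- Total variation distance of two densities on `X × 𝒴` with respect to the product of Lebesgue
measure and counting measure. -/
def tvdOn {d : ℕ} {𝒴 : Type*} [Fintype 𝒴] (X : Set (EuclideanSpace ℝ (Fin d)))
    (p q : EuclideanSpace ℝ (Fin d) → 𝒴 → ℝ) : ℝ :=
  (1 / 2) * ∑ y, ∫ x in X, |p x y - q x y|

/-- Joint density `p(x, y)`: for each `y`, the Lebesgue density of `A ↦ P (A × {y})`. -/
def densJoint {d : ℕ} {𝒴 : Type*} [MeasurableSpace 𝒴]
    (P : Measure (EuclideanSpace ℝ (Fin d) × 𝒴)) (x : EuclideanSpace ℝ (Fin d)) (y : 𝒴) : ℝ :=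
  (((P.restrict (Prod.snd ⁻¹' {y})).map Prod.fst).rnDeriv volume x).toReal

/-- Lebesgue density of the covariate. -/
def densMarginal {d : ℕ} {𝒴 : Type*} [MeasurableSpace 𝒴]
    (P : Measure (EuclideanSpace ℝ (Fin d) × 𝒴)) (x : EuclideanSpace ℝ (Fin d)) : ℝ :=
  ((P.map Prod.fst).rnDeriv volume x).toReal

/-- Kernel-smoothed joint estimate from the first `n` observations, with kernel `K` and
bandwidth `h`. -/
def kdeJoint {d : ℕ} {𝒴 : Type*} [DecidableEq 𝒴] (K : EuclideanSpace ℝ (Fin d) → ℝ) (h : ℝ)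
    (z : ℕ → EuclideanSpace ℝ (Fin d) × 𝒴) (n : ℕ)
    (x : EuclideanSpace ℝ (Fin d)) (y : 𝒴) : ℝ :=
  (1 / (n : ℝ)) * ∑ i ∈ Finset.range n,
    (if (z i).2 = y then 1 else 0) * ((1 / h ^ d) * K (h⁻¹ • ((z i).1 - x)))

/-- Marginal of `kdeJoint` in the covariate. -/
def kdeMarginal {d : ℕ} {𝒴 : Type*} [Fintype 𝒴] [DecidableEq 𝒴]
    (K : EuclideanSpace ℝ (Fin d) → ℝ) (h : ℝ)
    (z : ℕ → EuclideanSpace ℝ (Fin d) × 𝒴) (n : ℕ) (x : EuclideanSpace ℝ (Fin d)) : ℝ :=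
  ∑ y, kdeJoint K h z n x y

/-- `n_y`: how often the outcome `y` occurs among the first `n` observations. -/
def outcomeCount {𝒳 𝒴 : Type*} [DecidableEq 𝒴] (z : ℕ → 𝒳 × 𝒴) (n : ℕ) (y : 𝒴) : ℕ :=
  ((Finset.range n).filter fun i => (z i).2 = y).card

/-- `min_y n_y`, for a nonempty finite set `𝒴` of outcomes. -/
def minOutcomeCount {𝒳 𝒴 : Type*} [DecidableEq 𝒴] (z : ℕ → 𝒳 × 𝒴) (n : ℕ) : ℕ :=
  ⨅ y, outcomeCount z n y

end

/-!
For a finite covariate space the empirical mass functions converge pointwise by the strong law of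
large numbers, and the total variation distance is a continuous function of their finitely many
values.

For covariates in `ℝ^d`, the condition that the counts of all outcomes are large implies that `n`
is large, so it is enough to take the limit `n → ∞`. The total variation distance changes by at
most `∑ y, ‖p̂ n (·, y) - p (·, y)‖₁` when the estimates are replaced by the true densities
(`abs_tvdOn_hybridJoint_sub_le`), and everything reduces to Devroye's theorem: for every `y` the
kernel estimate converges to `p (·, y)` in `L¹`, almost surely
(`ae_tendsto_integral_abs_kernelEstimate_sub`). No smoothness of `p` and no rate for the bandwidth
beyond `n h ^ d → ∞` are available. The reasons for the convergence are the following.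

* *Concentration.* Changing one observation moves the `L¹` error by at most `2 ‖K‖₁ / n`.
  McDiarmid's inequality and the Borel-Cantelli lemma therefore reduce almost sure convergence to
  convergence of the expected error (`ae_tendsto_zero_of_bounded_differences`).
* *Bias.* The expectation of the estimate is an average of translates of `p (·, y)`, and
  translation is continuous in `L¹` (`tendsto_integral_abs_smoothing_sub`).
* *Fluctuation.* After truncation the estimate is supported on a fixed ball and has variance
  `O(1 / (n h ^ d))`, while the truncation error is small in `L¹` uniformly in `n`
  (`tendsto_integral_abs_empiricalFluctuation`).
-/

/-! ### Bounded differences -/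

/-- Exponential moment bound for a function of `n` independent variables with bounded differences:
one coordinate is integrated out at a time, and Hoeffding's lemma bounds its contribution. The
parameter is `c ^ 2` rather than the optimal `c ^ 2 / 4`, since the values of one coordinate are
only located in an interval of length `2 * c`. -/
theorem integral_exp_sub_integral_le_of_bounded_differences {E : Type*} [MeasurableSpace E]
    (P : Measure E) [IsProbabilityMeasure P] {c C : ℝ} (hc : 0 ≤ c) (t : ℝ) (n : ℕ) :
    ∀ g : (Fin n → E) → ℝ, Measurable g → (∀ z, |g z| ≤ C) →
      (∀ z i e, |g (Function.update z i e) - g z| ≤ c) →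
      ∫ z, Real.exp (t * (g z - ∫ w, g w ∂Measure.pi fun _ : Fin n => P))
        ∂(Measure.pi fun _ : Fin n => P) ≤ Real.exp (n * (c ^ 2 * t ^ 2 / 2)) := by
  induction n with
  | zero =>
    intro g _ _ _
    have hconst : ∀ z w : Fin 0 → E, g z = g w := fun z w => by rw [Subsingleton.elim z w]
    have h1 : ∀ z, g z - ∫ w, g w ∂(Measure.pi fun _ : Fin 0 => P) = 0 := by
      intro z
      simp [hconst _ z]
    simp [h1]
  | succ n ih =>
    intro g hg hC hd
    have hmp := (measurePreserving_piFinSuccAbove (fun _ : Fin (n + 1) => P) 0).symm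
    set e := (MeasurableEquiv.piFinSuccAbove (fun _ : Fin (n + 1) => E) 0).symm with he
    set ν := Measure.pi fun _ : Fin n => P with hν
    have hint : ∀ F : (Fin (n + 1) → E) → ℝ,
        ∫ z, F z ∂(Measure.pi fun _ : Fin (n + 1) => P) = ∫ q, F (e q) ∂(P.prod ν) := fun F =>
      (hmp.integral_comp' F).symm
    have hge : Measurable fun q => g (e q) := hg.comp e.measurable
    set G : (Fin n → E) → ℝ := fun xs => ∫ x, g (e (x, xs)) ∂P with hG
    have hsec : ∀ xs, Measurable fun x => g (e (x, xs)) := fun xs =>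
      hge.comp (measurable_id.prodMk measurable_const)
    have hsecI : ∀ xs, Integrable (fun x => g (e (x, xs))) P := fun xs =>
      Integrable.of_bound (hsec xs).aestronglyMeasurable C (ae_of_all _ fun x => hC _)
    have hGm : Measurable G := hge.stronglyMeasurable.integral_prod_left'.measurable
    have hGC : ∀ xs, |G xs| ≤ C := fun xs => by
      have := norm_integral_le_of_norm_le_const (μ := P) (f := fun x => g (e (x, xs)))
        (ae_of_all _ fun x => hC _)
      simpa using this
    have hcons : ∀ x xs, e (x, xs) = Fin.cons (α := fun _ => E) x xs := fun x xs =>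
      Fin.insertNth_zero' x xs
    have hins : ∀ x xs i a, e (x, Function.update xs i a) =
        Function.update (e (x, xs)) (Fin.succ i) a := fun x xs i a => by
      simp only [hcons, Fin.cons_update]
    have hGd : ∀ xs i a, |G (Function.update xs i a) - G xs| ≤ c := fun xs i a => by
      simp only [hG]
      rw [← integral_sub (hsecI _) (hsecI _)]
      have := norm_integral_le_of_norm_le_const (μ := P)
        (f := fun x => g (e (x, Function.update xs i a)) - g (e (x, xs))) (C := c)
        (ae_of_all _ fun x => by rw [hins]; exact hd _ _ _)
      simpa using this
    have hgI : Integrable (fun q => g (e q)) (P.prod ν) :=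
      Integrable.of_bound hge.aestronglyMeasurable C (ae_of_all _ fun x => hC _)
    have hmean : ∫ z, g z ∂(Measure.pi fun _ : Fin (n + 1) => P) = ∫ xs, G xs ∂ν := by
      rw [hint, integral_prod_symm _ hgI]
    rw [hmean, hint (fun z => Real.exp (t * (g z - ∫ xs, G xs ∂ν)))]
    set m := ∫ xs, G xs ∂ν with hm
    have hexpI : Integrable (fun q => Real.exp (t * (g (e q) - m))) (P.prod ν) := by
      refine Integrable.of_bound ((hge.sub_const m).const_mul t).exp.aestronglyMeasurable
        (Real.exp (|t| * (C + |m|))) (ae_of_all _ fun q => ?_)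
      rw [Real.norm_eq_abs, Real.abs_exp]
      refine Real.exp_le_exp.2 ((le_abs_self _).trans ?_)
      rw [abs_mul]
      gcongr
      exact (abs_sub _ _).trans (by gcongr; exact hC _)
    have hexpG : Integrable (fun xs => Real.exp (t * (G xs - m))) ν := by
      refine Integrable.of_bound (by fun_prop) (Real.exp (|t| * (C + |m|))) (ae_of_all _ fun q => ?_)
      rw [Real.norm_eq_abs, Real.abs_exp]
      refine Real.exp_le_exp.2 ((le_abs_self _).trans ?_)
      rw [abs_mul]
      gcongr
      exact (abs_sub _ _).trans (by gcongr; exact hGC _)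
    rw [integral_prod_symm _ hexpI]
    calc ∫ xs, ∫ x, Real.exp (t * (g (e (x, xs)) - m)) ∂P ∂ν
        ≤ ∫ xs, Real.exp (c ^ 2 * t ^ 2 / 2) * Real.exp (t * (G xs - m)) ∂ν := by
          refine integral_mono hexpI.integral_prod_right (hexpG.const_mul _) fun xs => ?_
          obtain ⟨x₀⟩ : Nonempty E := nonempty_of_isProbabilityMeasure P
          have hmem : ∀ᵐ x ∂P, g (e (x, xs)) ∈ Set.Icc (g (e (x₀, xs)) - c) (g (e (x₀, xs)) + c) := by
            refine ae_of_all _ fun x => ?_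
            have h0 : e (x, xs) = Function.update (e (x₀, xs)) 0 x := by
              simp only [hcons, Fin.update_cons_zero]
            have := abs_le.1 (hd (e (x₀, xs)) 0 x)
            rw [← h0] at this
            constructor <;> linarith [this.1, this.2]
          have hs := (hasSubgaussianMGF_of_mem_Icc (hsec xs).aemeasurable hmem).mgf_le t
          simp only [mgf] at hs
          have hpar : (((‖g (e (x₀, xs)) + c - (g (e (x₀, xs)) - c)‖₊ / 2) ^ 2 : NNReal) : ℝ)
              = c ^ 2 := by
            have : g (e (x₀, xs)) + c - (g (e (x₀, xs)) - c) = 2 * c := by ring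
            rw [this]
            push_cast
            rw [Real.norm_of_nonneg (by positivity)]
            ring
          rw [hpar] at hs
          calc ∫ x, Real.exp (t * (g (e (x, xs)) - m)) ∂P
              = ∫ x, Real.exp (t * (g (e (x, xs)) - G xs)) * Real.exp (t * (G xs - m)) ∂P := by
                congr 1; ext x; rw [← Real.exp_add]; congr 1; ring
            _ = (∫ x, Real.exp (t * (g (e (x, xs)) - G xs)) ∂P) * Real.exp (t * (G xs - m)) :=
                integral_mul_const _ _
            _ ≤ _ := by gcongr
      _ = Real.exp (c ^ 2 * t ^ 2 / 2) * ∫ xs, Real.exp (t * (G xs - m)) ∂ν :=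
          integral_const_mul _ _
      _ ≤ Real.exp (c ^ 2 * t ^ 2 / 2) * Real.exp (n * (c ^ 2 * t ^ 2 / 2)) := by
          gcongr
          exact ih G hGm hGC hGd
      _ = Real.exp ((n + 1 : ℕ) * (c ^ 2 * t ^ 2 / 2)) := by
          rw [← Real.exp_add]; push_cast; ring_nf

/-- **McDiarmid's inequality**, upper tail, before optimising the Chernoff parameter `t`. -/
theorem measureReal_integral_add_le_of_bounded_differences {E : Type*} [MeasurableSpace E]
    (P : Measure E) [IsProbabilityMeasure P] {c C : ℝ} (hc : 0 ≤ c) {t : ℝ} (ht : 0 ≤ t) (ε : ℝ)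
    {n : ℕ} {g : (Fin n → E) → ℝ} (hg : Measurable g) (hC : ∀ z, |g z| ≤ C)
    (hd : ∀ z i e, |g (Function.update z i e) - g z| ≤ c) :
    (Measure.pi fun _ : Fin n => P).real {z | ε ≤ g z - ∫ w, g w ∂Measure.pi fun _ : Fin n => P} ≤
      Real.exp (-t * ε + n * (c ^ 2 * t ^ 2 / 2)) := by
  set m := ∫ w, g w ∂Measure.pi fun _ : Fin n => P
  have hexpI : Integrable (fun q => Real.exp (t * (g q - m))) (Measure.pi fun _ : Fin n => P) := by
    refine Integrable.of_bound (by fun_prop) (Real.exp (|t| * (C + |m|))) (ae_of_all _ fun q => ?_)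
    rw [Real.norm_eq_abs, Real.abs_exp]
    refine Real.exp_le_exp.2 ((le_abs_self _).trans ?_)
    rw [abs_mul]
    gcongr
    exact (abs_sub _ _).trans (by gcongr; exact hC _)
  refine (measure_ge_le_exp_mul_mgf ε ht hexpI).trans ?_
  rw [Real.exp_add]
  gcongr
  exact integral_exp_sub_integral_le_of_bounded_differences P hc t n g hg hC hd

/-- Functionals of the first `n` of a sequence of i.i.d. variables which have differences `O(1 / n)`
and whose expectations tend to zero converge to zero almost surely. -/
theorem ae_tendsto_zero_of_bounded_differences {Ω E : Type*} [MeasurableSpace Ω]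
    [MeasurableSpace E] {μ : Measure Ω} [IsProbabilityMeasure μ] {P : Measure E}
    {Z : ℕ → Ω → E} (hZ : ∀ i, Measurable (Z i)) (hP : ∀ i, μ.map (Z i) = P)
    (hind : iIndepFun Z μ) {c C : ℝ} (hc : 0 ≤ c) {g : ∀ n, (Fin n → E) → ℝ}
    (hg : ∀ n, Measurable (g n)) (hg0 : ∀ n z, 0 ≤ g n z) (hC : ∀ n z, g n z ≤ C)
    (hd : ∀ n z i e, |g n (Function.update z i e) - g n z| ≤ c / n)
    (hmean : Tendsto (fun n => ∫ ω, g n (fun i => Z i ω) ∂μ) atTop (𝓝 0)) :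
    ∀ᵐ ω ∂μ, Tendsto (fun n => g n (fun i => Z i ω)) atTop (𝓝 0) := by
  have : IsProbabilityMeasure P := hP 0 ▸ Measure.isProbabilityMeasure_map (hZ 0).aemeasurable
  have hmap : ∀ n, μ.map (fun ω (i : Fin n) => Z i ω) = Measure.pi fun _ : Fin n => P := by
    intro n
    have h := (iIndepFun_iff_map_fun_eq_pi_map (fun i : Fin n => (hZ i).aemeasurable)).1
      (hind.precomp (g := fun i : Fin n => (i : ℕ)) Fin.val_injective)
    rw [h]
    simp [hP]
  have hZn : ∀ n, Measurable fun ω (i : Fin n) => Z i ω := fun n =>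
    measurable_pi_lambda _ fun i => hZ i
  have hmean' : ∀ n, ∫ ω, g n (fun i => Z i ω) ∂μ =
      ∫ w, g n w ∂Measure.pi fun _ : Fin n => P := fun n => by
    rw [← hmap n, integral_map (hZn n).aemeasurable (hg n).aestronglyMeasurable]
  -- Each tail event has exponentially small probability, so Borel-Cantelli applies.
  have key : ∀ ε : ℝ, 0 < ε → ∀ᵐ ω ∂μ, ∀ᶠ n in atTop,
      g n (fun i => Z i ω) - ∫ ω, g n (fun i => Z i ω) ∂μ < ε := by
    intro ε hε
    -- The Chernoff parameter is `n * t`; `t` makes the linear term beat the quadratic one.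
    set t := ε / (c ^ 2 + 1) with ht
    have htpos : 0 < t := by positivity
    set r := Real.exp (-(t * ε / 2)) with hr
    have hr1 : r < 1 := by
      rw [hr, Real.exp_lt_one_iff]; simp; positivity
    have hbound : ∀ n : ℕ,
        μ {ω | ε ≤ g n (fun i => Z i ω) - ∫ ω, g n (fun i => Z i ω) ∂μ} ≤
          ENNReal.ofReal (r ^ n) := by
      intro n
      have hms : MeasurableSet {z : Fin n → E |
          ε ≤ g n z - ∫ w, g n w ∂Measure.pi fun _ : Fin n => P} :=
        measurableSet_le measurable_const ((hg n).sub_const _)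
      have h1 := measureReal_integral_add_le_of_bounded_differences P (c := c / n) (by positivity)
        (t := n * t) (by positivity) ε (hg n)
        (fun z => (abs_of_nonneg (hg0 n z)).trans_le (hC n z)) (hd n)
      have h2 : μ {ω | ε ≤ g n (fun i => Z i ω) - ∫ ω, g n (fun i => Z i ω) ∂μ} =
          (Measure.pi fun _ : Fin n => P)
            {z | ε ≤ g n z - ∫ w, g n w ∂Measure.pi fun _ : Fin n => P} := by
        rw [← hmap n, Measure.map_apply (hZn n) (by rw [hmap n]; exact hms), hmap n, hmean']
        rfl
      rw [h2, ← ofReal_measureReal]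
      refine ENNReal.ofReal_le_ofReal (h1.trans ?_)
      rw [hr, ← Real.exp_nat_mul]
      refine Real.exp_le_exp.2 ?_
      rcases Nat.eq_zero_or_pos n with rfl | hn
      · simp
      have hn' : (0 : ℝ) < n := by exact_mod_cast hn
      have hct : c ^ 2 * t ≤ ε := by
        rw [ht, mul_div_assoc', div_le_iff₀ (by positivity)]
        nlinarith
      have : (n : ℝ) * ((c / n) ^ 2 * (n * t) ^ 2 / 2) = n * (c ^ 2 * t * t / 2) := by
        field_simp
      rw [this]
      have h3 : c ^ 2 * t * t ≤ ε * t := by gcongr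
      nlinarith
    have hsum : ∑' n, μ {ω | ε ≤ g n (fun i => Z i ω) - ∫ ω, g n (fun i => Z i ω) ∂μ} ≠ ⊤ := by
      refine ne_top_of_le_ne_top ?_ (ENNReal.tsum_le_tsum hbound)
      exact (summable_geometric_of_lt_one (Real.exp_pos _).le hr1).tsum_ofReal_ne_top
    filter_upwards [ae_eventually_notMem hsum] with ω hω
    filter_upwards [hω] with n hn
    simpa using hn
  have hall : ∀ᵐ ω ∂μ, ∀ k : ℕ, ∀ᶠ n in atTop,
      g n (fun i => Z i ω) - ∫ ω, g n (fun i => Z i ω) ∂μ < 1 / ((k : ℝ) + 1) :=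
    ae_all_iff.2 fun k => key _ (by positivity)
  filter_upwards [hall] with ω hω
  rw [Metric.tendsto_atTop']
  intro ε hε
  obtain ⟨k, hk⟩ := exists_nat_one_div_lt (half_pos hε)
  have h2 := hmean.eventually (gt_mem_nhds (half_pos hε))
  obtain ⟨N, hN⟩ := eventually_atTop.1 ((hω k).and h2)
  refine ⟨N, fun n hn => ?_⟩
  obtain ⟨h3, h4⟩ := hN n hn.le
  rw [Real.dist_eq, sub_zero, abs_of_nonneg (hg0 _ _)]
  linarith

/-! ### Fluctuations of empirical means in `L¹` -/

/-- The centred empirical mean of a family of functions `Φ · s` on `E` along the sample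
`Z 0 ω, …, Z (n - 1) ω`, as a function of the pair `(ω, s)`. With `Φ z x` the kernel bump of the
observation `z` at the location `x`, it is the kernel estimate minus its expectation. -/
noncomputable def empiricalFluctuation {Ω E S : Type*} [MeasurableSpace E] (P : Measure E)
    (Z : ℕ → Ω → E) (n : ℕ) (Φ : E → S → ℝ) (q : Ω × S) : ℝ :=
  (1 / (n : ℝ)) * ∑ i ∈ Finset.range n, Φ (Z i q.1) q.2 - ∫ z, Φ z q.2 ∂P

section Fluctuation

variable {Ω E S : Type*} [MeasurableSpace Ω] [MeasurableSpace E] [MeasurableSpace S]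
  {μ : Measure Ω} [IsProbabilityMeasure μ] {P : Measure E} {ν : Measure S} [SigmaFinite ν]
  {Z : ℕ → Ω → E}

theorem measurePreserving_prodMap_id [IsProbabilityMeasure P]
    (hZ : ∀ i, Measurable (Z i)) (hP : ∀ i, μ.map (Z i) = P)
    (i : ℕ) : MeasurePreserving (Prod.map (Z i) (id : S → S)) (μ.prod ν) (P.prod ν) :=
  MeasurePreserving.prod ⟨hZ i, hP i⟩ (MeasurePreserving.id ν)

theorem integrable_empiricalFluctuation [IsProbabilityMeasure P]
    (hZ : ∀ i, Measurable (Z i)) (hP : ∀ i, μ.map (Z i) = P)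
    {Φ : E → S → ℝ} (hΦ : Integrable (Function.uncurry Φ) (P.prod ν)) (n : ℕ) :
    Integrable (empiricalFluctuation P Z n Φ) (μ.prod ν) := by
  refine Integrable.sub (Integrable.const_mul (integrable_finsetSum _ fun i _ => ?_) _) ?_
  · exact (measurePreserving_prodMap_id hZ hP i).integrable_comp_of_integrable hΦ
  · exact hΦ.integral_prod_right.comp_snd μ

/-- The crude bound, which does not gain from averaging; it is applied to truncation errors. -/
theorem integral_abs_empiricalFluctuation_le [IsProbabilityMeasure P]
    (hZ : ∀ i, Measurable (Z i)) (hP : ∀ i, μ.map (Z i) = P)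
    {Φ : E → S → ℝ} (hΦ : Integrable (Function.uncurry Φ) (P.prod ν)) (n : ℕ) :
    ∫ q, |empiricalFluctuation P Z n Φ q| ∂(μ.prod ν) ≤ 2 * ∫ q, |Φ q.1 q.2| ∂(P.prod ν) := by
  set A := ∫ q, |Φ q.1 q.2| ∂(P.prod ν) with hA
  have hA0 : 0 ≤ A := integral_nonneg fun _ => abs_nonneg _
  have hmp := measurePreserving_prodMap_id (ν := ν) hZ hP
  have hi : ∀ i, Integrable (fun q : Ω × S => |Φ (Z i q.1) q.2|) (μ.prod ν) := fun i =>
    ((hmp i).integrable_comp_of_integrable hΦ).abs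
  have hiA : ∀ i, ∫ q : Ω × S, |Φ (Z i q.1) q.2| ∂(μ.prod ν) = A := fun i => by
    have h := integral_map (μ := μ.prod ν) (hmp i).measurable.aemeasurable
      (f := fun q : E × S => |Φ q.1 q.2|)
      (by rw [(hmp i).map_eq]; exact hΦ.abs.aestronglyMeasurable)
    rw [(hmp i).map_eq] at h
    exact h.symm
  have hs : Integrable (fun s => ∫ z, |Φ z s| ∂P) ν := hΦ.abs.integral_prod_right
  have hsA : ∫ q : Ω × S, (∫ z, |Φ z q.2| ∂P) ∂(μ.prod ν) = A := by
    rw [integral_fun_snd (μ := μ) (fun s => ∫ z, |Φ z s| ∂P)]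
    simp only [probReal_univ, one_smul, hA]
    exact (integral_prod_symm _ hΦ.abs).symm
  calc ∫ q, |empiricalFluctuation P Z n Φ q| ∂(μ.prod ν)
      ≤ ∫ q : Ω × S, ((1 / (n : ℝ)) * ∑ i ∈ Finset.range n, |Φ (Z i q.1) q.2| +
          ∫ z, |Φ z q.2| ∂P) ∂(μ.prod ν) := by
        refine integral_mono (integrable_empiricalFluctuation hZ hP hΦ n).abs
          (Integrable.add (Integrable.const_mul (integrable_finsetSum _ fun i _ => hi i) _)
            (hs.comp_snd μ)) fun q => ?_
        refine (abs_sub _ _).trans (add_le_add ?_ abs_integral_le_integral_abs)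
        rw [abs_mul, abs_of_nonneg (by positivity)]
        gcongr
        exact Finset.abs_sum_le_sum_abs _ _
    _ = (1 / (n : ℝ)) * (n * A) + A := by
        rw [integral_add (Integrable.const_mul (integrable_finsetSum _ fun i _ => hi i) _)
          (hs.comp_snd μ), integral_const_mul, integral_finsetSum _ fun i _ => hi i, hsA]
        simp [hiA]
    _ ≤ 2 * A := by
        rcases Nat.eq_zero_or_pos n with rfl | hn
        · simp; linarith
        · have : (n : ℝ) ≠ 0 := by positivity
          field_simp
          linarith

theorem integral_sq_centred_mean_le [IsProbabilityMeasure P]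
    (hZ : ∀ i, Measurable (Z i)) (hP : ∀ i, μ.map (Z i) = P) (hind : iIndepFun Z μ)
    {φ : E → ℝ} (hφ : Measurable φ) {M : ℝ} (hM : ∀ z, |φ z| ≤ M) {n : ℕ} (hn : 0 < n) :
    ∫ ω, ((1 / (n : ℝ)) * ∑ i ∈ Finset.range n, φ (Z i ω) - ∫ z, φ z ∂P) ^ 2 ∂μ ≤
      (1 / (n : ℝ)) * ∫ z, φ z ^ 2 ∂P := by
  have hL : ∀ i, MemLp (fun ω => φ (Z i ω)) 2 μ := fun i =>
    MemLp.of_bound (hφ.comp (hZ i)).aestronglyMeasurable M (ae_of_all _ fun ω => hM _)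
  have hI : ∀ i, Integrable (fun ω => φ (Z i ω)) μ := fun i => (hL i).integrable one_le_two
  have hE : ∀ i, ∫ ω, φ (Z i ω) ∂μ = ∫ z, φ z ∂P := fun i => by
    rw [← hP i, integral_map (hZ i).aemeasurable hφ.aestronglyMeasurable]
  have hV : ∀ i, variance (fun ω => φ (Z i ω)) μ ≤ ∫ z, φ z ^ 2 ∂P := fun i => by
    refine (variance_le_expectation_sq (hL i).aestronglyMeasurable).trans_eq ?_
    rw [← hP i, integral_map (hZ i).aemeasurable (hφ.pow_const 2).aestronglyMeasurable]
    rfl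
  have hn' : (n : ℝ) ≠ 0 := by positivity
  set X : Ω → ℝ := fun ω => (1 / (n : ℝ)) * ∑ i ∈ Finset.range n, φ (Z i ω) with hX
  have hXE : ∫ ω, X ω ∂μ = ∫ z, φ z ∂P := by
    simp only [hX]
    rw [integral_const_mul, integral_finsetSum _ fun i _ => hI i]
    simp [hE]
    field_simp
  have hXm : AEMeasurable X μ := by
    refine Measurable.aemeasurable ?_
    exact (Finset.measurable_fun_sum _ fun i _ => hφ.comp (hZ i)).const_mul _
  have hvar : variance X μ = ∫ ω, (X ω - ∫ z, φ z ∂P) ^ 2 ∂μ := by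
    rw [variance_eq_integral hXm, hXE]
  rw [← hvar]
  simp only [hX]
  rw [variance_const_mul]
  have hsum : variance (fun ω => ∑ i ∈ Finset.range n, φ (Z i ω)) μ =
      ∑ i ∈ Finset.range n, variance (fun ω => φ (Z i ω)) μ := by
    have := IndepFun.variance_sum (μ := μ) (s := Finset.range n)
      (X := fun i ω => φ (Z i ω)) (fun i _ => hL i)
      (fun i _ j _ hij => (hind.indepFun hij).comp hφ hφ)
    rw [← this]
    congr 1
    ext ω
    simp
  rw [hsum]
  calc (1 / (n : ℝ)) ^ 2 * ∑ i ∈ Finset.range n, variance (fun ω => φ (Z i ω)) μ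
      ≤ (1 / (n : ℝ)) ^ 2 * ∑ i ∈ Finset.range n, ∫ z, φ z ^ 2 ∂P := by
        gcongr
        exact hV _
    _ = _ := by
        simp
        field_simp

/-- For functions supported on a set of finite measure, the `L¹` size of the fluctuation is
controlled by its variance. The free parameter `δ` replaces the Cauchy-Schwarz inequality. -/
theorem integral_abs_empiricalFluctuation_le_of_bounded [IsProbabilityMeasure P]
    (hZ : ∀ i, Measurable (Z i)) (hP : ∀ i, μ.map (Z i) = P) (hind : iIndepFun Z μ)
    {Φ : E → S → ℝ} (hΦ : Measurable (Function.uncurry Φ)) {M : ℝ} (hM : ∀ z s, |Φ z s| ≤ M)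
    {B : Set S} (hB : MeasurableSet B) (hBν : ν B ≠ ⊤) (hΦB : ∀ z, ∀ s ∉ B, Φ z s = 0)
    {δ : ℝ} (hδ : 0 < δ) {n : ℕ} (hn : 0 < n) :
    ∫ q, |empiricalFluctuation P Z n Φ q| ∂(μ.prod ν) ≤
      δ * ν.real B / 2 + (∫ q, Φ q.1 q.2 ^ 2 ∂(P.prod ν)) / (2 * δ * n) := by
  obtain ⟨z₀⟩ : Nonempty E := nonempty_of_isProbabilityMeasure P
  have hΦdom : ∀ k : ℕ, Integrable (fun q : E × S => Φ q.1 q.2 ^ (k + 1)) (P.prod ν) := by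
    intro k
    have h1 : IntegrableOn (fun q : E × S => Φ q.1 q.2 ^ (k + 1)) (Set.univ ×ˢ B) (P.prod ν) := by
      refine Measure.integrableOn_of_bounded (M := M ^ (k + 1)) ?_
        (hΦ.pow_const _).aestronglyMeasurable (ae_of_all _ fun q => ?_)
      · rw [Measure.prod_prod]; simpa using hBν
      · rw [norm_pow]
        exact pow_le_pow_left₀ (norm_nonneg _) (hM _ _) _
    refine h1.integrable_of_forall_notMem_eq_zero fun q hq => ?_
    rw [hΦB _ _ (by simpa using hq)]; simp
  have hΦI : Integrable (Function.uncurry Φ) (P.prod ν) := by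
    simpa [Function.uncurry_def] using hΦdom 0
  have hΦ2 := hΦdom 1
  have hFI := integrable_empiricalFluctuation hZ hP hΦI n
  have hFm : Measurable (empiricalFluctuation P Z n Φ) := by
    refine Measurable.sub (Measurable.const_mul (Finset.measurable_fun_sum _ fun i _ => ?_) _) ?_
    · exact hΦ.comp (((hZ i).comp measurable_fst).prodMk measurable_snd)
    · exact (hΦ.stronglyMeasurable.integral_prod_left'.measurable).comp measurable_snd
  have hFM : ∀ q, |empiricalFluctuation P Z n Φ q| ≤ 2 * M := by
    intro q
    have hM0 : 0 ≤ M := (abs_nonneg _).trans (hM z₀ q.2)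
    refine (abs_sub _ _).trans ?_
    have h1 : |(1 / (n : ℝ)) * ∑ i ∈ Finset.range n, Φ (Z i q.1) q.2| ≤ M := by
      rw [abs_mul, abs_of_nonneg (by positivity)]
      have : |∑ i ∈ Finset.range n, Φ (Z i q.1) q.2| ≤ n * M := by
        refine (Finset.abs_sum_le_sum_abs _ _).trans ?_
        refine (Finset.sum_le_sum fun i _ => hM (Z i q.1) q.2).trans_eq ?_
        simp
      have hn' : (0 : ℝ) < n := by exact_mod_cast hn
      rw [one_div, inv_mul_le_iff₀ hn']
      exact this
    have h2 : |∫ z, Φ z q.2 ∂P| ≤ M := by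
      simpa using norm_integral_le_of_norm_le_const (μ := P) (f := fun z => Φ z q.2)
        (ae_of_all _ fun z => hM z _)
    linarith
  have hFB : ∀ q : Ω × S, q.2 ∉ B → empiricalFluctuation P Z n Φ q = 0 := by
    intro q hq
    simp [empiricalFluctuation, hΦB _ _ hq]
  have hF2 : Integrable (fun q => empiricalFluctuation P Z n Φ q ^ 2) (μ.prod ν) := by
    refine (hFI.bdd_mul hFm.aestronglyMeasurable (c := 2 * M) (ae_of_all _ hFM)).congr
      (ae_of_all _ fun q => ?_)
    simp [sq]
  have hF2le : ∫ q, empiricalFluctuation P Z n Φ q ^ 2 ∂(μ.prod ν) ≤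
      (1 / (n : ℝ)) * ∫ q, Φ q.1 q.2 ^ 2 ∂(P.prod ν) := by
    rw [integral_prod_symm _ hF2, integral_prod_symm _ hΦ2, ← integral_const_mul]
    refine integral_mono hF2.integral_prod_right (hΦ2.integral_prod_right.const_mul _) fun s => ?_
    exact integral_sq_centred_mean_le hZ hP hind
      (hΦ.comp (measurable_id.prodMk measurable_const)) (fun z => hM z s) hn
  have hIB : Integrable ((Set.univ ×ˢ B).indicator fun _ : Ω × S => (1 : ℝ)) (μ.prod ν) := by
    refine (integrable_indicator_iff (MeasurableSet.univ.prod hB)).2 (integrableOn_const ?_)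
    rw [Measure.prod_prod]; simpa using hBν
  calc ∫ q, |empiricalFluctuation P Z n Φ q| ∂(μ.prod ν)
      ≤ ∫ q, ((δ / 2) * (Set.univ ×ˢ B).indicator (fun _ : Ω × S => (1 : ℝ)) q +
          (1 / (2 * δ)) * empiricalFluctuation P Z n Φ q ^ 2) ∂(μ.prod ν) := by
        refine integral_mono hFI.abs ((hIB.const_mul _).add (hF2.const_mul _)) fun q => ?_
        by_cases hq : q.2 ∈ B
        · have : q ∈ (Set.univ ×ˢ B : Set (Ω × S)) := by simpa using hq
          simp only [Set.indicator_of_mem this]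
          -- the arithmetic-geometric mean inequality `2 δ |a| ≤ δ ^ 2 + a ^ 2`
          have h := sq_nonneg (|empiricalFluctuation P Z n Φ q| - δ)
          rw [← sq_abs (empiricalFluctuation P Z n Φ q)]
          generalize |empiricalFluctuation P Z n Φ q| = a at *
          have : δ / 2 * 1 + 1 / (2 * δ) * a ^ 2 - a = (a - δ) ^ 2 / (2 * δ) := by
            field_simp; ring
          have : 0 ≤ (a - δ) ^ 2 / (2 * δ) := by positivity
          linarith
        · have : q ∉ (Set.univ ×ˢ B : Set (Ω × S)) := by simpa using hq
          simp [hFB q hq, Set.indicator_of_notMem this]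
    _ = (δ / 2) * ν.real B +
          (1 / (2 * δ)) * ∫ q, empiricalFluctuation P Z n Φ q ^ 2 ∂(μ.prod ν) := by
        rw [integral_add (hIB.const_mul _) (hF2.const_mul _), integral_const_mul,
          integral_const_mul, integral_indicator_const _ (MeasurableSet.univ.prod hB),
          measureReal_prod_prod]
        simp
    _ ≤ (δ / 2) * ν.real B +
          (1 / (2 * δ)) * ((1 / (n : ℝ)) * ∫ q, Φ q.1 q.2 ^ 2 ∂(P.prod ν)) := by gcongr
    _ = _ := by
        have hn' : (n : ℝ) ≠ 0 := by positivity
        field_simp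

/-- The crude bound for `Φ - Ψ` together with the variance bound for the truncation `Ψ`. -/
theorem integral_abs_empiricalFluctuation_le_of_truncation [IsProbabilityMeasure P]
    (hZ : ∀ i, Measurable (Z i)) (hP : ∀ i, μ.map (Z i) = P) (hind : iIndepFun Z μ)
    {Φ Ψ : E → S → ℝ} (hΦ : Integrable (Function.uncurry Φ) (P.prod ν))
    (hΨ : Integrable (Function.uncurry Ψ) (P.prod ν))
    (hΨm : Measurable (Function.uncurry Ψ)) {M : ℝ} (hM : ∀ z s, |Ψ z s| ≤ M)
    {B : Set S} (hB : MeasurableSet B) (hBν : ν B ≠ ⊤) (hΨB : ∀ z, ∀ s ∉ B, Ψ z s = 0)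
    {δ : ℝ} (hδ : 0 < δ) {n : ℕ} (hn : 0 < n) :
    ∫ q, |empiricalFluctuation P Z n Φ q| ∂(μ.prod ν) ≤
      2 * ∫ q, |Φ q.1 q.2 - Ψ q.1 q.2| ∂(P.prod ν) +
      (δ * ν.real B / 2 + (∫ q, Ψ q.1 q.2 ^ 2 ∂(P.prod ν)) / (2 * δ * n)) := by
  set R : E → S → ℝ := fun z s => Φ z s - Ψ z s with hR
  have hRI : Integrable (Function.uncurry R) (P.prod ν) := hΦ.sub hΨ
  have hsplit : ∀ᵐ q ∂(μ.prod ν), empiricalFluctuation P Z n Φ q =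
      empiricalFluctuation P Z n R q + empiricalFluctuation P Z n Ψ q := by
    have h : ∀ᵐ s ∂ν, Integrable (fun z => Φ z s) P ∧ Integrable (fun z => Ψ z s) P :=
      hΦ.prod_left_ae.and hΨ.prod_left_ae
    have h' := Measure.quasiMeasurePreserving_snd (μ := μ) (ν := ν) |>.ae h
    filter_upwards [h'] with q hq
    simp only [empiricalFluctuation, hR]
    rw [integral_sub hq.1 hq.2, Finset.sum_sub_distrib]
    ring
  have h1 := integral_abs_empiricalFluctuation_le hZ hP hRI n
  have h2 := integral_abs_empiricalFluctuation_le_of_bounded hZ hP hind hΨm hM hB hBν hΨB hδ hn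
  have hIR := (integrable_empiricalFluctuation hZ hP hRI n).abs
  have hIΨ := (integrable_empiricalFluctuation hZ hP hΨ n).abs
  calc ∫ q, |empiricalFluctuation P Z n Φ q| ∂(μ.prod ν)
      ≤ ∫ q, (|empiricalFluctuation P Z n R q| + |empiricalFluctuation P Z n Ψ q|) ∂(μ.prod ν) := by
        refine integral_mono_ae (integrable_empiricalFluctuation hZ hP hΦ n).abs (hIR.add hIΨ) ?_
        filter_upwards [hsplit] with q hq
        rw [hq]
        exact abs_add_le _ _
    _ = _ := integral_add hIR hIΨ
    _ ≤ _ := add_le_add h1 h2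

end Fluctuation

/-! ### Smoothing by a kernel -/

section Kernel

variable {V : Type*} [NormedAddCommGroup V] [NormedSpace ℝ V] [FiniteDimensional ℝ V]
  [MeasurableSpace V] [BorelSpace V] {ν : Measure V} [ν.IsAddHaarMeasure]

/-- Translation is continuous in `L¹`. -/
theorem tendsto_integral_abs_comp_add_sub {p : V → ℝ} (hp : Integrable p ν) :
    Tendsto (fun a : V => ∫ x, |p (x + a) - p x| ∂ν) (𝓝 0) (𝓝 0) := by
  set f : Lp ℝ 1 ν := hp.toL1 p with hf
  let τ : C(V, C(V, V)) := (ContinuousMap.mk (fun q : V × V => q.2 + q.1) (by fun_prop)).curry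
  have hτ : ∀ a, MeasurePreserving (τ a) ν ν := fun a => measurePreserving_add_right ν a
  have hcont : Continuous fun a : V => Lp.compMeasurePreserving (τ a) (hτ a) f :=
    continuous_const.compMeasurePreservingLp τ.continuous hτ (by simp)
  have h0 : Lp.compMeasurePreserving (τ 0) (hτ 0) f = f := by
    refine Lp.ext ?_
    refine (Lp.coeFn_compMeasurePreserving f (hτ 0)).trans (ae_of_all _ fun x => ?_)
    simp [τ]
  have hlim : Tendsto (fun a : V => ‖Lp.compMeasurePreserving (τ a) (hτ a) f - f‖) (𝓝 0) (𝓝 0) := by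
    have := ((hcont.tendsto 0).sub_const f).norm
    rwa [h0, sub_self, norm_zero] at this
  refine hlim.congr fun a => ?_
  rw [L1.norm_eq_integral_norm]
  refine integral_congr_ae ?_
  have h1 := hp.coeFn_toL1
  filter_upwards [Lp.coeFn_sub (Lp.compMeasurePreserving (τ a) (hτ a) f) f,
    Lp.coeFn_compMeasurePreserving f (hτ a), h1,
    (hτ a).quasiMeasurePreserving.ae h1] with x e1 e2 e3 e4
  rw [e1, Pi.sub_apply, e2, Function.comp_apply, e4, e3, Real.norm_eq_abs]
  rfl

theorem integral_rescale_sub_left {h : ℝ} (hh : 0 < h) (G : V → ℝ) (a : V) :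
    ∫ x, (1 / h ^ Module.finrank ℝ V) * G (h⁻¹ • (a - x)) ∂ν = ∫ v, G v ∂ν := by
  rw [integral_const_mul, integral_sub_left_eq_self (fun x => G (h⁻¹ • x)) ν a,
    Measure.integral_comp_inv_smul_of_nonneg ν G hh.le, smul_eq_mul]
  field_simp

theorem integral_rescale_sub_right {h : ℝ} (hh : 0 < h) (G p : V → ℝ) (x : V) :
    ∫ u, (1 / h ^ Module.finrank ℝ V) * G (h⁻¹ • (u - x)) * p u ∂ν =
      ∫ v, G v * p (x + h • v) ∂ν := by
  have h1 := integral_add_left_eq_self (μ := ν)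
    (fun u => (1 / h ^ Module.finrank ℝ V) * G (h⁻¹ • (u - x)) * p u) x
  rw [← h1]
  have h2 := integral_rescale_sub_left (ν := ν) hh (fun v => G v * p (x + h • v)) 0
  rw [← h2, ← integral_neg_eq_self]
  congr 1
  ext u
  have : h • h⁻¹ • (0 - u) = -u := by rw [smul_inv_smul₀ hh.ne', zero_sub]
  simp only [this]
  simp
  ring

theorem integrable_mul_comp_add_smul {K p : V → ℝ} (hKm : Measurable K) (hK : Integrable K ν)
    (hpm : Measurable p) (hp : Integrable p ν) (h : ℝ) :
    Integrable (fun q : V × V => K q.2 * p (q.1 + h • q.2)) (ν.prod ν) := by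
  have hm : Measurable fun q : V × V => K q.2 * p (q.1 + h • q.2) :=
    (hKm.comp measurable_snd).mul (hpm.comp (by fun_prop))
  rw [integrable_prod_iff' hm.aestronglyMeasurable]
  refine ⟨ae_of_all _ fun v => (hp.comp_add_right (h • v)).const_mul (K v), ?_⟩
  have : ∀ v, ∫ x, ‖K v * p (x + h • v)‖ ∂ν = ‖K v‖ * ∫ x, ‖p x‖ ∂ν := by
    intro v
    simp_rw [norm_mul]
    rw [integral_const_mul, integral_add_right_eq_self (fun x => ‖p x‖)]
  simp_rw [this]
  exact hK.norm.mul_const _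

/-- The bias of a kernel estimate tends to zero in `L¹`: it is bounded by the average of
`‖p (· + h v) - p‖₁` under `|K v| dv`, to which dominated convergence applies. -/
theorem tendsto_integral_abs_smoothing_sub {K p : V → ℝ} (hKm : Measurable K)
    (hK : Integrable K ν) (hK1 : ∫ v, K v ∂ν = 1) (hpm : Measurable p) (hp : Integrable p ν)
    {h : ℕ → ℝ} (hh : Tendsto h atTop (𝓝 0)) :
    Tendsto (fun n => ∫ x, |(∫ v, K v * p (x + h n • v) ∂ν) - p x| ∂ν) atTop (𝓝 0) := by
  set ω : V → ℝ := fun a => ∫ x, |p (x + a) - p x| ∂ν with hω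
  have hω0 : ∀ a, 0 ≤ ω a := fun a => integral_nonneg fun _ => abs_nonneg _
  have hωb : ∀ a, ω a ≤ 2 * ∫ x, |p x| ∂ν := by
    intro a
    calc ω a ≤ ∫ x, (|p (x + a)| + |p x|) ∂ν :=
          integral_mono ((hp.comp_add_right a).sub hp).abs ((hp.comp_add_right a).abs.add hp.abs)
            fun x => abs_sub _ _
      _ = _ := by
          rw [integral_add (hp.comp_add_right a).abs hp.abs,
            integral_add_right_eq_self (fun x => |p x|)]
          ring
  have hint : ∀ n, Integrable (fun q : V × V => K q.2 * (p (q.1 + h n • q.2) - p q.1))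
      (ν.prod ν) := by
    intro n
    have h1 := integrable_mul_comp_add_smul hKm hK hpm hp (h n)
    have h2 := integrable_mul_comp_add_smul hKm hK hpm hp 0
    refine (h1.sub h2).congr (ae_of_all _ fun q => ?_)
    simp [mul_sub]
  have hωm : ∀ n, AEStronglyMeasurable (fun v => |K v| * ω (h n • v)) ν := by
    intro n
    refine (hint n).abs.integral_prod_right.aestronglyMeasurable.congr (ae_of_all _ fun v => ?_)
    simp only [abs_mul, hω]
    rw [integral_const_mul]
  have hle : ∀ n, ∫ x, |(∫ v, K v * p (x + h n • v) ∂ν) - p x| ∂ν ≤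
      ∫ v, |K v| * ω (h n • v) ∂ν := by
    intro n
    have h1 := integrable_mul_comp_add_smul hKm hK hpm hp (h n)
    calc ∫ x, |(∫ v, K v * p (x + h n • v) ∂ν) - p x| ∂ν
        ≤ ∫ x, ∫ v, |K v * (p (x + h n • v) - p x)| ∂ν ∂ν := by
          refine integral_mono_ae (h1.integral_prod_left.sub hp).abs
            (hint n).abs.integral_prod_left ?_
          filter_upwards [h1.prod_right_ae] with x hx
          have : (∫ v, K v * p (x + h n • v) ∂ν) - p x =
              ∫ v, K v * (p (x + h n • v) - p x) ∂ν := by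
            simp_rw [mul_sub]
            rw [integral_sub hx (hK.mul_const _), integral_mul_const, hK1, one_mul]
          rw [this]
          exact abs_integral_le_integral_abs
      _ = ∫ v, ∫ x, |K v * (p (x + h n • v) - p x)| ∂ν ∂ν := integral_integral_swap (hint n).abs
      _ = _ := by
          simp only [abs_mul, hω]
          simp_rw [integral_const_mul]
  refine squeeze_zero (fun n => integral_nonneg fun _ => abs_nonneg _) hle ?_
  have hdom := tendsto_integral_of_dominated_convergence
    (F := fun n v => |K v| * ω (h n • v)) (f := fun _ => (0 : ℝ)) (μ := ν)
    (fun v => |K v| * (2 * ∫ x, |p x| ∂ν)) hωm (hK.abs.mul_const _)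
    (fun n => ae_of_all _ fun v => by
      rw [Real.norm_of_nonneg (mul_nonneg (abs_nonneg _) (hω0 _))]
      gcongr
      exact hωb _)
    (ae_of_all _ fun v => by
      have h1 : Tendsto (fun n => h n • v) atTop (𝓝 0) := by simpa using hh.smul_const v
      simpa using ((tendsto_integral_abs_comp_add_sub hp).comp h1).const_mul |K v|)
  simpa using hdom

end Kernel

/-! ### Kernel estimates -/

/-- The function `x ↦ h ^ (-dim V) * G (z, (ξ z - x) / h)`. The location `ξ z` of the observation
`z` and the kernel `G (z, ·)`, which may depend on the observation, are kept abstract: a weight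
`1 {y = y₀}` and a truncation of the kernel are both absorbed in `G`. -/
noncomputable def rescaledKernel {E V : Type*} [NormedAddCommGroup V] [NormedSpace ℝ V]
    (ξ : E → V) (h : ℝ) (G : E × V → ℝ) (z : E) (x : V) : ℝ :=
  (1 / h ^ Module.finrank ℝ V) * G (z, h⁻¹ • (ξ z - x))

theorem integrable_weight_mul_kernel {E V : Type*} [MeasurableSpace E] [MeasurableSpace V]
    {P : Measure E} [IsProbabilityMeasure P] {ν : Measure V} [SFinite ν] {w : E → ℝ} {K : V → ℝ}
    (hw : Measurable w)
    (hw1 : ∀ z, |w z| ≤ 1) (hK : Integrable K ν) :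
    Integrable (fun q : E × V => w q.1 * K q.2) (P.prod ν) :=
  (Integrable.of_bound hw.aestronglyMeasurable 1 (ae_of_all _ hw1)).mul_prod hK

section KernelEstimate

variable {V : Type*} [NormedAddCommGroup V] [NormedSpace ℝ V] [FiniteDimensional ℝ V]
  [MeasurableSpace V] [BorelSpace V] {ν : Measure V} [ν.IsAddHaarMeasure]
  {E : Type*} {ξ : E → V}


theorem integral_abs_rescaledKernel {h : ℝ} (hh : 0 < h) (G : E × V → ℝ) (z : E) :
    ∫ x, |rescaledKernel ξ h G z x| ∂ν = ∫ v, |G (z, v)| ∂ν := by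
  rw [← integral_rescale_sub_left hh (fun v => |G (z, v)|) (ξ z)]
  congr 1
  ext x
  rw [rescaledKernel, abs_mul, abs_of_nonneg (by positivity)]

theorem integrable_rescaledKernel_right {h : ℝ} (hh : 0 < h) {G : E × V → ℝ} {z : E}
    (hG : Integrable (fun v => G (z, v)) ν) : Integrable (rescaledKernel ξ h G z) ν :=
  ((hG.comp_smul (inv_ne_zero hh.ne')).comp_sub_left (ξ z)).const_mul _

variable [MeasurableSpace E] {P : Measure E}

theorem measurable_rescaledKernel (hξ : Measurable ξ) {G : E × V → ℝ} (hG : Measurable G)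
    (h : ℝ) : Measurable (Function.uncurry (rescaledKernel ξ h G)) := by
  refine (hG.comp (measurable_fst.prodMk ?_)).const_mul _
  exact ((hξ.comp measurable_fst).sub measurable_snd).const_smul h⁻¹

theorem integrable_rescaledKernel [SFinite P] (hξ : Measurable ξ) {h : ℝ} (hh : 0 < h)
    {G : E × V → ℝ}
    (hGm : Measurable G) (hG : Integrable G (P.prod ν)) :
    Integrable (Function.uncurry (rescaledKernel ξ h G)) (P.prod ν) := by
  rw [integrable_prod_iff (measurable_rescaledKernel hξ hGm h).aestronglyMeasurable]
  constructor
  · filter_upwards [hG.prod_right_ae] with z hz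
    exact integrable_rescaledKernel_right hh hz
  · refine hG.norm.integral_prod_left.congr (ae_of_all _ fun z => ?_)
    exact (integral_abs_rescaledKernel hh G z).symm

theorem integral_abs_rescaledKernel_prod [SFinite P] (hξ : Measurable ξ) {h : ℝ} (hh : 0 < h)
    {G : E × V → ℝ} (hGm : Measurable G) (hG : Integrable G (P.prod ν)) :
    ∫ q, |rescaledKernel ξ h G q.1 q.2| ∂(P.prod ν) = ∫ q, |G q| ∂(P.prod ν) := by
  have hR : Integrable (fun q : E × V => |rescaledKernel ξ h G q.1 q.2|) (P.prod ν) :=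
    (integrable_rescaledKernel hξ hh hGm hG).abs
  rw [integral_prod _ hR, integral_prod _ hG.abs]
  congr 1
  ext z
  exact integral_abs_rescaledKernel hh G z

variable {Ω : Type*} [MeasurableSpace Ω] {μ : Measure Ω} [IsProbabilityMeasure μ]
  {Z : ℕ → Ω → E} {w : E → ℝ} {K : V → ℝ}

/-- The stochastic part of a kernel estimate tends to zero in mean in `L¹`. The kernel and the
observations are truncated at a level `M`; the error is small uniformly in the bandwidth, and the
truncated estimate has variance `O(1 / (n h ^ dim V))` and a support of bounded volume. -/
theorem tendsto_integral_abs_empiricalFluctuation [IsProbabilityMeasure P]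
    (hZ : ∀ i, Measurable (Z i)) (hP : ∀ i, μ.map (Z i) = P) (hind : iIndepFun Z μ)
    (hξ : Measurable ξ) (hw : Measurable w) (hw1 : ∀ z, |w z| ≤ 1)
    (hKm : Measurable K) (hK : Integrable K ν) {h : ℕ → ℝ} (hpos : ∀ n, 0 < h n)
    (hh : Tendsto h atTop (𝓝 0))
    (hnh : Tendsto (fun n : ℕ => (n : ℝ) * h n ^ Module.finrank ℝ V) atTop atTop) :
    Tendsto (fun n => ∫ q, |empiricalFluctuation P Z n
      (rescaledKernel ξ (h n) fun q => w q.1 * K q.2) q| ∂(μ.prod ν)) atTop (𝓝 0) := by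
  set G : E × V → ℝ := fun q => w q.1 * K q.2 with hGdef
  have hGm : Measurable G := (hw.comp measurable_fst).mul (hKm.comp measurable_snd)
  have hG : Integrable G (P.prod ν) := integrable_weight_mul_kernel hw hw1 hK
  set A : ℕ → Set (E × V) := fun M =>
    {q | ‖ξ q.1‖ ≤ M} ∩ ({q | |K q.2| ≤ M} ∩ {q | ‖q.2‖ ≤ M}) with hA
  have hAm : ∀ M, MeasurableSet (A M) := fun M =>
    (measurableSet_le (hξ.comp measurable_fst).norm measurable_const).inter
      ((measurableSet_le (hKm.comp measurable_snd).abs measurable_const).inter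
        (measurableSet_le measurable_snd.norm measurable_const))
  have hGMm : ∀ M, Measurable ((A M).indicator G) := fun M => hGm.indicator (hAm M)
  have hGM : ∀ M, Integrable ((A M).indicator G) (P.prod ν) := fun M => hG.indicator (hAm M)
  -- The mass removed by truncation tends to zero, uniformly in the bandwidth.
  have hρ : Tendsto (fun M => ∫ q, |G q - (A M).indicator G q| ∂(P.prod ν)) atTop (𝓝 0) := by
    have hdom := tendsto_integral_of_dominated_convergence
      (F := fun M q => |G q - (A M).indicator G q|) (f := fun _ => (0 : ℝ)) (μ := P.prod ν)
      (fun q => |G q|) (fun M => (hG.sub (hGM M)).abs.aestronglyMeasurable) hG.abs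
      (fun M => ae_of_all _ fun q => by
        by_cases hq : q ∈ A M
        · simp [Set.indicator_of_mem hq]
        · simp [Set.indicator_of_notMem hq])
      (ae_of_all _ fun q => by
        refine tendsto_const_nhds.congr' ?_
        filter_upwards [eventually_ge_atTop ⌈‖ξ q.1‖⌉₊, eventually_ge_atTop ⌈|K q.2|⌉₊,
          eventually_ge_atTop ⌈‖q.2‖⌉₊] with M h1 h2 h3
        have hq : q ∈ A M := ⟨Nat.ceil_le.1 h1, Nat.ceil_le.1 h2, Nat.ceil_le.1 h3⟩
        simp [Set.indicator_of_mem hq])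
    simpa using hdom
  rw [Metric.tendsto_nhds]
  intro ε hε
  obtain ⟨M, hM⟩ := (hρ.eventually (gt_mem_nhds (show 0 < ε / 8 by positivity))).exists
  set B : Set V := Metric.closedBall 0 (2 * M) with hB
  have hBν : ν B ≠ ⊤ := (isCompact_closedBall _ _).measure_lt_top.ne
  set δ : ℝ := ε / (2 * (ν.real B + 1)) with hδ
  have hB0 : 0 ≤ ν.real B := measureReal_nonneg
  have hδ0 : 0 < δ := by positivity
  have hδB : δ * ν.real B / 2 ≤ ε / 4 := by
    rw [hδ, div_mul_eq_mul_div, div_div, div_le_div_iff₀ (by positivity) (by positivity)]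
    nlinarith
  set I := ∫ q, |G q| ∂(P.prod ν) with hI
  have hlim : Tendsto (fun n : ℕ => M * I / (2 * δ) * ((n : ℝ) * h n ^ Module.finrank ℝ V)⁻¹)
      atTop (𝓝 0) := by
    simpa using hnh.inv_tendsto_atTop.const_mul (M * I / (2 * δ))
  filter_upwards [eventually_gt_atTop 0, hh.eventually (gt_mem_nhds zero_lt_one),
    hlim.eventually (gt_mem_nhds (show 0 < ε / 4 by positivity))] with n hn hn1 hn2
  have hhn := hpos n
  set D := h n ^ Module.finrank ℝ V with hD
  have hD0 : 0 < D := by positivity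
  have hGMb : ∀ q, |(A M).indicator G q| ≤ M := by
    intro q
    by_cases hq : q ∈ A M
    · rw [Set.indicator_of_mem hq, hGdef, abs_mul]
      calc |w q.1| * |K q.2| ≤ 1 * M :=
            mul_le_mul (hw1 _) hq.2.1 (abs_nonneg _) zero_le_one
        _ = M := one_mul _
    · simp [Set.indicator_of_notMem hq]
  have hsupp : ∀ z, ∀ x ∉ B, rescaledKernel ξ (h n) ((A M).indicator G) z x = 0 := by
    intro z x hx
    have hq : (z, (h n)⁻¹ • (ξ z - x)) ∉ A M := by
      rintro ⟨h1, -, h3⟩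
      refine hx ?_
      rw [hB, mem_closedBall_zero_iff]
      simp only [Set.mem_ofPred_eq] at h1 h3
      have hx' : x = ξ z - h n • ((h n)⁻¹ • (ξ z - x)) := by
        rw [smul_inv_smul₀ hhn.ne']; abel
      have h4 : ‖h n • ((h n)⁻¹ • (ξ z - x))‖ ≤ M := by
        rw [norm_smul, Real.norm_of_nonneg hhn.le]
        calc h n * ‖(h n)⁻¹ • (ξ z - x)‖ ≤ 1 * M := by gcongr
          _ = M := one_mul _
      calc ‖x‖ = ‖ξ z - h n • ((h n)⁻¹ • (ξ z - x))‖ := by rw [← hx']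
        _ ≤ ‖ξ z‖ + ‖h n • ((h n)⁻¹ • (ξ z - x))‖ := norm_sub_le _ _
        _ ≤ 2 * M := by linarith
    simp [rescaledKernel, Set.indicator_of_notMem hq]
  have hbdd : ∀ z x, |rescaledKernel ξ (h n) ((A M).indicator G) z x| ≤ 1 / D * M := by
    intro z x
    rw [rescaledKernel, abs_mul, abs_of_nonneg (show 0 ≤ 1 / h n ^ Module.finrank ℝ V by positivity)]
    gcongr
    exact hGMb _
  have hsq : ∫ q, rescaledKernel ξ (h n) ((A M).indicator G) q.1 q.2 ^ 2 ∂(P.prod ν) ≤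
      1 / D * M * I := by
    have hIM := integrable_rescaledKernel hξ hhn (hGMm M) (hGM M)
    calc ∫ q, rescaledKernel ξ (h n) ((A M).indicator G) q.1 q.2 ^ 2 ∂(P.prod ν)
        ≤ ∫ q, 1 / D * M * |rescaledKernel ξ (h n) ((A M).indicator G) q.1 q.2| ∂(P.prod ν) := by
          refine integral_mono_of_nonneg (ae_of_all _ fun q => sq_nonneg _)
            (hIM.abs.const_mul _) (ae_of_all _ fun q => ?_)
          simp only
          rw [← sq_abs, sq]
          gcongr
          exact hbdd _ _
      _ = 1 / D * M * ∫ q, |(A M).indicator G q| ∂(P.prod ν) := by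
          rw [integral_const_mul, integral_abs_rescaledKernel_prod hξ hhn (hGMm M) (hGM M)]
      _ ≤ 1 / D * M * I := by
          gcongr
          refine integral_mono (hGM M).abs hG.abs fun q => ?_
          by_cases hq : q ∈ A M
          · simp [Set.indicator_of_mem hq]
          · simp [Set.indicator_of_notMem hq]
  have hdiff : ∫ q, |rescaledKernel ξ (h n) G q.1 q.2 -
      rescaledKernel ξ (h n) ((A M).indicator G) q.1 q.2| ∂(P.prod ν) =
      ∫ q, |G q - (A M).indicator G q| ∂(P.prod ν) := by
    have := integral_abs_rescaledKernel_prod (G := fun q => G q - (A M).indicator G q) hξ hhn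
      (hGm.sub (hGMm M)) (hG.sub (hGM M))
    rw [← this]
    simp only [rescaledKernel, mul_sub]
  have hmain := integral_abs_empiricalFluctuation_le_of_truncation hZ hP hind
    (integrable_rescaledKernel hξ hhn hGm hG) (integrable_rescaledKernel hξ hhn (hGMm M) (hGM M))
    (measurable_rescaledKernel hξ (hGMm M) (h n)) hbdd Metric.isClosed_closedBall.measurableSet
    hBν hsupp hδ0 hn
  rw [hdiff] at hmain
  have hn0 : (0 : ℝ) < n := by exact_mod_cast hn
  have hlast : (∫ q, rescaledKernel ξ (h n) ((A M).indicator G) q.1 q.2 ^ 2 ∂(P.prod ν)) /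
      (2 * δ * n) < ε / 4 := by
    refine lt_of_le_of_lt ?_ hn2
    calc _ ≤ 1 / D * M * I / (2 * δ * n) := by gcongr
      _ = _ := by field_simp
  rw [Real.dist_eq, sub_zero, abs_of_nonneg (integral_nonneg fun _ => abs_nonneg _)]
  linarith

/-- **Strong `L¹` consistency of kernel density estimates** (Devroye), for weighted observations:
`p` is the density of the image under `ξ` of `P` weighted by `w`, which need not have mass one. -/
theorem ae_tendsto_integral_abs_kernelEstimate_sub [IsProbabilityMeasure P]
    (hZ : ∀ i, Measurable (Z i)) (hP : ∀ i, μ.map (Z i) = P) (hind : iIndepFun Z μ)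
    (hξ : Measurable ξ) (hw : Measurable w) (hw1 : ∀ z, |w z| ≤ 1)
    (hKm : Measurable K) (hK : Integrable K ν) (hK1 : ∫ v, K v ∂ν = 1)
    {p : V → ℝ} (hpm : Measurable p) (hp : Integrable p ν)
    (hdens : ∀ φ : V → ℝ, Measurable φ → ∫ z, w z * φ (ξ z) ∂P = ∫ u, φ u * p u ∂ν)
    {h : ℕ → ℝ} (hpos : ∀ n, 0 < h n) (hh : Tendsto h atTop (𝓝 0))
    (hnh : Tendsto (fun n : ℕ => (n : ℝ) * h n ^ Module.finrank ℝ V) atTop atTop) :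
    ∀ᵐ ω ∂μ, Tendsto (fun n : ℕ => ∫ x, |(1 / (n : ℝ)) * ∑ i ∈ Finset.range n,
      rescaledKernel ξ (h n) (fun q => w q.1 * K q.2) (Z i ω) x - p x| ∂ν) atTop (𝓝 0) := by
  set G : E × V → ℝ := fun q => w q.1 * K q.2 with hGdef
  have hGm : Measurable G := (hw.comp measurable_fst).mul (hKm.comp measurable_snd)
  have hG : Integrable G (P.prod ν) := integrable_weight_mul_kernel hw hw1 hK
  set Φ : ℕ → E → V → ℝ := fun n => rescaledKernel ξ (h n) G with hΦ
  have hΦm : ∀ n, Measurable (Function.uncurry (Φ n)) := fun n =>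
    measurable_rescaledKernel hξ hGm (h n)
  have hΦz : ∀ n z, Integrable (Φ n z) ν := fun n z =>
    integrable_rescaledKernel_right (hpos n) (hK.const_mul (w z))
  set κ := ∫ v, |K v| ∂ν with hκ
  have hκ0 : 0 ≤ κ := integral_nonneg fun _ => abs_nonneg _
  have hΦκ : ∀ n z, ∫ x, |Φ n z x| ∂ν ≤ κ := by
    intro n z
    rw [hΦ, integral_abs_rescaledKernel (hpos n)]
    refine integral_mono (hK.const_mul (w z)).abs hK.abs fun v => ?_
    simp only [hGdef, abs_mul]
    exact mul_le_of_le_one_left (abs_nonneg _) (hw1 z)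
  set a : ∀ n, (Fin n → E) → V → ℝ := fun n z x => (1 / (n : ℝ)) * ∑ i, Φ n (z i) x with ha
  have haI : ∀ n z, Integrable (a n z) ν := fun n z =>
    (integrable_finsetSum _ fun i _ => hΦz n _).const_mul _
  have hapI : ∀ n z, Integrable (fun x => |a n z x - p x|) ν := fun n z => ((haI n z).sub hp).abs
  have hsum : ∀ (n : ℕ) (ω : Ω) x, (1 / (n : ℝ)) * ∑ i ∈ Finset.range n, Φ n (Z i ω) x =
      a n (fun i => Z i ω) x := fun n ω x => by
    simp only [ha]
    rw [Finset.sum_range]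
  set g : ∀ n, (Fin n → E) → ℝ := fun n z => ∫ x, |a n z x - p x| ∂ν with hgdef
  have hgm : ∀ n, Measurable (g n) := by
    intro n
    have : Measurable (Function.uncurry fun (z : Fin n → E) x => |a n z x - p x|) := by
      refine (Measurable.sub (Measurable.const_mul
        (Finset.measurable_fun_sum _ fun i _ => ?_) _) (hpm.comp measurable_snd)).abs
      have hi : Measurable fun q : (Fin n → E) × V => (q.1 i, q.2) :=
        ((measurable_pi_apply i).comp measurable_fst).prodMk measurable_snd
      exact (hΦm n).comp hi
    exact this.stronglyMeasurable.integral_prod_right.measurable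
  have hg0 : ∀ n z, 0 ≤ g n z := fun n z => integral_nonneg fun _ => abs_nonneg _
  have hgC : ∀ n z, g n z ≤ κ + ∫ x, |p x| ∂ν := by
    intro n z
    calc g n z ≤ ∫ x, ((1 / (n : ℝ)) * ∑ i, |Φ n (z i) x| + |p x|) ∂ν := by
          refine integral_mono (hapI n z)
            (((integrable_finsetSum _ fun i _ => (hΦz n _).abs).const_mul _).add hp.abs)
            fun x => (abs_sub _ _).trans (add_le_add ?_ le_rfl)
          simp only [ha]
          rw [abs_mul, abs_of_nonneg (by positivity)]
          gcongr
          exact Finset.abs_sum_le_sum_abs _ _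
      _ = (1 / (n : ℝ)) * ∑ i, ∫ x, |Φ n (z i) x| ∂ν + ∫ x, |p x| ∂ν := by
          rw [integral_add ((integrable_finsetSum _ fun i _ => (hΦz n _).abs).const_mul _) hp.abs,
            integral_const_mul, integral_finsetSum _ fun i _ => (hΦz n _).abs]
      _ ≤ (1 / (n : ℝ)) * (n * κ) + ∫ x, |p x| ∂ν := by
          gcongr
          refine (Finset.sum_le_sum fun i _ => hΦκ n (z i)).trans_eq ?_
          simp
      _ ≤ κ + ∫ x, |p x| ∂ν := by
          gcongr
          rcases Nat.eq_zero_or_pos n with rfl | hn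
          · simpa using hκ0
          · have : (n : ℝ) ≠ 0 := by positivity
            field_simp
            rfl
  have hgd : ∀ n z i e, |g n (Function.update z i e) - g n z| ≤ 2 * κ / n := by
    intro n z i e
    have hdiff : ∀ x, a n (Function.update z i e) x - a n z x =
        (1 / (n : ℝ)) * (Φ n e x - Φ n (z i) x) := by
      intro x
      simp only [ha]
      rw [← mul_sub, ← Finset.sum_sub_distrib, Finset.sum_eq_single i]
      · simp
      · intro j _ hj
        simp [Function.update_of_ne hj]
      · simp
    calc |g n (Function.update z i e) - g n z|
        = |∫ x, (|a n (Function.update z i e) x - p x| - |a n z x - p x|) ∂ν| := by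
          rw [integral_sub (hapI n _) (hapI n _)]
      _ ≤ ∫ x, |(|a n (Function.update z i e) x - p x| - |a n z x - p x|)| ∂ν :=
          abs_integral_le_integral_abs
      _ ≤ ∫ x, (1 / (n : ℝ)) * (|Φ n e x| + |Φ n (z i) x|) ∂ν := by
          refine integral_mono ((hapI n _).sub (hapI n _)).abs
            (((hΦz n _).abs.add (hΦz n _).abs).const_mul _) fun x => ?_
          refine (abs_abs_sub_abs_le _ _).trans ?_
          rw [sub_sub_sub_cancel_right, hdiff, abs_mul, abs_of_nonneg (by positivity)]
          gcongr
          exact abs_sub _ _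
      _ = (1 / (n : ℝ)) * (∫ x, |Φ n e x| ∂ν + ∫ x, |Φ n (z i) x| ∂ν) := by
          rw [integral_const_mul, integral_add (hΦz n _).abs (hΦz n _).abs]
      _ ≤ (1 / (n : ℝ)) * (κ + κ) := by
          gcongr <;> exact hΦκ _ _
      _ = 2 * κ / n := by ring
  -- The expectation of the estimate is the density smoothed at scale `h n`.
  have hm : ∀ n x, ∫ z, Φ n z x ∂P = ∫ v, K v * p (x + h n • v) ∂ν := by
    intro n x
    rw [← integral_rescale_sub_right (hpos n),
      ← hdens (fun u => (1 / h n ^ Module.finrank ℝ V) * K ((h n)⁻¹ • (u - x))) (by fun_prop)]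
    congr 1
    ext z
    simp only [hΦ, rescaledKernel, hGdef]
    ring
  have hmean : Tendsto (fun n => ∫ ω, g n (fun i => Z i ω) ∂μ) atTop (𝓝 0) := by
    have hfl := tendsto_integral_abs_empiricalFluctuation hZ hP hind hξ hw hw1 hKm hK hpos hh hnh
    have hbias := tendsto_integral_abs_smoothing_sub hKm hK hK1 hpm hp hh
    have hadd := hfl.add hbias
    rw [add_zero] at hadd
    refine squeeze_zero (fun n => integral_nonneg fun _ => hg0 _ _) (fun n => ?_) hadd
    have hF := integrable_empiricalFluctuation (ν := ν) hZ hP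
      (integrable_rescaledKernel hξ (hpos n) hGm hG) n
    have hmI : Integrable (fun x => |(∫ v, K v * p (x + h n • v) ∂ν) - p x|) ν :=
      ((integrable_mul_comp_add_smul hKm hK hpm hp (h n)).integral_prod_left.sub hp).abs
    rw [integral_prod _ hF.abs]
    calc ∫ ω, g n (fun i => Z i ω) ∂μ
        ≤ ∫ ω, (∫ x, |empiricalFluctuation P Z n (Φ n) (ω, x)| ∂ν +
            ∫ x, |(∫ v, K v * p (x + h n • v) ∂ν) - p x| ∂ν) ∂μ := by
          refine integral_mono_of_nonneg (ae_of_all _ fun ω => hg0 _ _)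
            (hF.abs.integral_prod_left.add (integrable_const _)) ?_
          filter_upwards [hF.prod_right_ae] with ω hω
          rw [← integral_add hω.abs hmI]
          refine integral_mono (hapI n _) (hω.abs.add hmI) fun x => ?_
          have : a n (fun i => Z i ω) x - p x = empiricalFluctuation P Z n (Φ n) (ω, x) +
              ((∫ v, K v * p (x + h n • v) ∂ν) - p x) := by
            simp only [empiricalFluctuation]
            rw [hsum, hm]
            ring
          simp only [this]
          exact abs_add_le _ _
      _ = _ := by
          rw [integral_add hF.abs.integral_prod_left (integrable_const _)]
          simp
  have hfin := ae_tendsto_zero_of_bounded_differences hZ hP hind (by positivity) hgm hg0 hgC hgd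
    hmean
  filter_upwards [hfin] with ω hω
  exact hω.congr fun n => integral_congr_ae (ae_of_all _ fun x => by simp only [← hsum, hΦ])

end KernelEstimate

/-! ### Finite covariate space -/

section FiniteCovariates

theorem ae_tendsto_empirical_mean_indicator {Ω E : Type*} [MeasurableSpace Ω] [MeasurableSpace E]
    {μ : Measure Ω} [IsProbabilityMeasure μ] {P : Measure E} {Z : ℕ → Ω → E}
    (hZ : ∀ i, Measurable (Z i)) (hP : ∀ i, μ.map (Z i) = P) (hind : iIndepFun Z μ)
    {s : Set E} (hs : MeasurableSet s) :
    ∀ᵐ ω ∂μ, Tendsto (fun n : ℕ => (1 / (n : ℝ)) *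
      ∑ i ∈ Finset.range n, s.indicator (fun _ => (1 : ℝ)) (Z i ω)) atTop (𝓝 (P.real s)) := by
  have hm : Measurable (s.indicator fun _ => (1 : ℝ)) := measurable_const.indicator hs
  have hI : Integrable (fun ω => s.indicator (fun _ => (1 : ℝ)) (Z 0 ω)) μ := by
    refine Integrable.of_bound (hm.comp (hZ 0)).aestronglyMeasurable 1 (ae_of_all _ fun ω => ?_)
    by_cases h : Z 0 ω ∈ s <;> simp [h]
  have h := strong_law_ae_real (fun i ω => s.indicator (fun _ => (1 : ℝ)) (Z i ω)) hI
    (fun i j hij => (hind.indepFun hij).comp hm hm)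
    (fun i => (IdentDistrib.mk (hZ i).aemeasurable (hZ 0).aemeasurable
      ((hP i).trans (hP 0).symm)).comp hm)
  have hE : ∫ ω, s.indicator (fun _ => (1 : ℝ)) (Z 0 ω) ∂μ = P.real s := by
    rw [← integral_map (μ := μ) (hZ 0).aemeasurable hm.aestronglyMeasurable, hP 0,
      integral_indicator_const _ hs]
    simp
  rw [hE] at h
  filter_upwards [h] with ω hω
  refine hω.congr fun n => ?_
  rw [div_eq_mul_inv, mul_comm, one_div]

theorem ae_tendsto_tvdFinite_empJoint {Ω 𝒳 𝒴 : Type*} [MeasurableSpace Ω] {μ : Measure Ω}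
    [IsProbabilityMeasure μ] [Fintype 𝒴] [DecidableEq 𝒴] [MeasurableSpace 𝒴]
    [MeasurableSingletonClass 𝒴] [Fintype 𝒳] [DecidableEq 𝒳] [MeasurableSpace 𝒳]
    [MeasurableSingletonClass 𝒳] {P : Measure (𝒳 × 𝒴)} {Z : ℕ → Ω → 𝒳 × 𝒴}
    (hZ : ∀ i, Measurable (Z i)) (hP : ∀ i, μ.map (Z i) = P) (hind : iIndepFun Z μ)
    (f : 𝒳 → 𝒴 → ℝ) :
    ∀ᵐ ω ∂μ, Tendsto
      (fun n : ℕ => tvdFinite (empJoint (fun i => Z i ω) n)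
        (hybridJoint f (empMarginal (fun i => Z i ω) n))) atTop
      (𝓝 (tvdFinite (massJoint P) (hybridJoint f (massMarginal P)))) := by
  have hjoint : ∀ᵐ ω ∂μ, ∀ x y, Tendsto (fun n : ℕ => empJoint (fun i => Z i ω) n x y) atTop
      (𝓝 (massJoint P x y)) := by
    refine ae_all_iff.2 fun x => ae_all_iff.2 fun y => ?_
    filter_upwards [ae_tendsto_empirical_mean_indicator hZ hP hind
      (measurableSet_singleton (x, y))] with ω hω
    refine hω.congr fun n => ?_
    simp [empJoint, Set.indicator_apply]
  have hmarg : ∀ᵐ ω ∂μ, ∀ x, Tendsto (fun n : ℕ => empMarginal (fun i => Z i ω) n x) atTop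
      (𝓝 (massMarginal P x)) := by
    refine ae_all_iff.2 fun x => ?_
    have hs : MeasurableSet (Prod.fst ⁻¹' {x} : Set (𝒳 × 𝒴)) :=
      measurable_fst (measurableSet_singleton x)
    filter_upwards [ae_tendsto_empirical_mean_indicator hZ hP hind hs] with ω hω
    rw [massMarginal, map_measureReal_apply measurable_fst (measurableSet_singleton x)]
    refine hω.congr fun n => ?_
    rw [empMarginal]
    congr 1
    refine Finset.sum_congr rfl fun i _ => ?_
    by_cases h : (Z i ω).1 = x <;> simp [h]
  filter_upwards [hjoint, hmarg] with ω h1 h2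
  refine Tendsto.const_mul _ (tendsto_finsetSum _ fun x _ => tendsto_finsetSum _ fun y _ => ?_)
  exact ((h1 x y).sub ((h2 x).const_mul (f x y))).abs

end FiniteCovariates

/-! ### Covariates in Euclidean space -/

section ContinuousCovariates

variable {d : ℕ} {𝒴 : Type*}

section KernelEstimator

variable [DecidableEq 𝒴] {K : EuclideanSpace ℝ (Fin d) → ℝ}

theorem integrable_kdeJoint (hK : Integrable K) {h : ℝ} (hh : 0 < h)
    (z : ℕ → EuclideanSpace ℝ (Fin d) × 𝒴) (n : ℕ) (y : 𝒴) :
    Integrable fun x => kdeJoint K h z n x y :=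
  (integrable_finsetSum _ fun i _ =>
    (((hK.comp_smul (inv_ne_zero hh.ne')).comp_sub_left (z i).1).const_mul _).const_mul _).const_mul _

theorem kdeJoint_ae_congr {K' : EuclideanSpace ℝ (Fin d) → ℝ} (hKK' : K =ᵐ[volume] K') {h : ℝ}
    (hh : 0 < h) (z : ℕ → EuclideanSpace ℝ (Fin d) × 𝒴) (n : ℕ) (y : 𝒴) :
    ∀ᵐ x, kdeJoint K h z n x y = kdeJoint K' h z n x y := by
  have hq : ∀ c : EuclideanSpace ℝ (Fin d), ∀ᵐ x, K (h⁻¹ • (c - x)) = K' (h⁻¹ • (c - x)) := by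
    intro c
    have h1 : ∀ᵐ x : EuclideanSpace ℝ (Fin d), K (h⁻¹ • x) = K' (h⁻¹ • x) :=
      (Measure.quasiMeasurePreserving_smul volume (inv_ne_zero hh.ne')).ae hKK'
    exact (Measure.measurePreserving_sub_left volume c).quasiMeasurePreserving.ae h1
  filter_upwards [ae_all_iff.2 fun i => hq (z i).1] with x hx
  simp only [kdeJoint, hx]

theorem minOutcomeCount_le {𝒳 : Type*} [Nonempty 𝒴] (z : ℕ → 𝒳 × 𝒴) (n : ℕ) :
    minOutcomeCount z n ≤ n := by
  obtain ⟨y⟩ := ‹Nonempty 𝒴›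
  refine (ciInf_le (OrderBot.bddBelow _) y).trans ?_
  exact (Finset.card_filter_le _ _).trans_eq (Finset.card_range n)

theorem comap_minOutcomeCount_atTop_le {𝒳 : Type*} [Nonempty 𝒴] (z : ℕ → 𝒳 × 𝒴) :
    comap (fun n => minOutcomeCount z n) atTop ≤ atTop :=
  tendsto_id'.1 (tendsto_atTop_mono (minOutcomeCount_le z) tendsto_comap)

end KernelEstimator

section Density

variable [MeasurableSpace 𝒴] {P : Measure (EuclideanSpace ℝ (Fin d) × 𝒴)}

theorem map_fst_restrict_absolutelyContinuous (hac : P.map Prod.fst ≪ volume) (y : 𝒴) :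
    (P.restrict (Prod.snd ⁻¹' {y})).map Prod.fst ≪ volume :=
  (Measure.map_mono Measure.restrict_le_self measurable_fst).absolutelyContinuous.trans hac

theorem measurable_densJoint (y : 𝒴) : Measurable fun x => densJoint P x y :=
  (Measure.measurable_rnDeriv _ _).ennreal_toReal

theorem integrable_densJoint [IsFiniteMeasure P] (y : 𝒴) : Integrable fun x => densJoint P x y :=
  Measure.integrable_toReal_rnDeriv

theorem integral_indicator_mul_eq_integral_densJoint [IsFiniteMeasure P] [DecidableEq 𝒴]
    [MeasurableSingletonClass 𝒴] (hac : P.map Prod.fst ≪ volume) (y : 𝒴)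
    {φ : EuclideanSpace ℝ (Fin d) → ℝ} (hφ : Measurable φ) :
    ∫ z, (if z.2 = y then 1 else 0) * φ z.1 ∂P = ∫ u, φ u * densJoint P u y := by
  have h1 := integral_rnDeriv_smul (f := φ) (map_fst_restrict_absolutelyContinuous hac y)
  have hs : MeasurableSet (Prod.snd ⁻¹' {y} : Set (EuclideanSpace ℝ (Fin d) × 𝒴)) :=
    measurable_snd (measurableSet_singleton y)
  rw [integral_map measurable_fst.aemeasurable hφ.aestronglyMeasurable,
    ← integral_indicator hs] at h1
  calc ∫ z, (if z.2 = y then 1 else 0) * φ z.1 ∂P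
      = ∫ z, (Prod.snd ⁻¹' {y}).indicator (fun z => φ z.1) z ∂P := by
        congr 1
        ext z
        by_cases h : z.2 = y <;> simp [h]
    _ = _ := h1.symm
    _ = _ := by
        congr 1
        ext u
        rw [smul_eq_mul, mul_comm, densJoint]

theorem densMarginal_ae_eq_sum_densJoint [IsFiniteMeasure P] [Fintype 𝒴]
    [MeasurableSingletonClass 𝒴] (hac : P.map Prod.fst ≪ volume) :
    ∀ᵐ x, densMarginal P x = ∑ y, densJoint P x y := by
  set Q : 𝒴 → Measure (EuclideanSpace ℝ (Fin d)) := fun y =>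
    (P.restrict (Prod.snd ⁻¹' {y})).map Prod.fst with hQ
  have hmQ : Measurable fun x => ∑ y, (Q y).rnDeriv volume x :=
    Finset.measurable_fun_sum _ fun y _ => Measure.measurable_rnDeriv _ _
  have hmeas : P.map Prod.fst = volume.withDensity fun x => ∑ y, (Q y).rnDeriv volume x := by
    ext s hs
    rw [withDensity_apply _ hs, lintegral_finsetSum _ fun y _ => Measure.measurable_rnDeriv _ _]
    have h1 : ∀ y, ∫⁻ x in s, (Q y).rnDeriv volume x = P.restrict (Prod.fst ⁻¹' s)
        (Prod.snd ⁻¹' {y}) := by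
      intro y
      have hs' : MeasurableSet (Prod.snd ⁻¹' {y} : Set (EuclideanSpace ℝ (Fin d) × 𝒴)) :=
        measurable_snd (measurableSet_singleton y)
      rw [Measure.setLIntegral_rnDeriv (map_fst_restrict_absolutelyContinuous hac y),
        Measure.map_apply measurable_fst hs, Measure.restrict_apply (measurable_fst hs),
        Measure.restrict_apply hs', Set.inter_comm]
    simp_rw [h1]
    rw [sum_measure_preimage_singleton _ fun y _ => measurable_snd (measurableSet_singleton y)]
    simp [Measure.map_apply measurable_fst hs]
  have h2 := Measure.rnDeriv_withDensity volume hmQ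
  rw [← hmeas] at h2
  have h3 : ∀ᵐ x, ∀ y, (Q y).rnDeriv volume x < ⊤ :=
    ae_all_iff.2 fun y => Measure.rnDeriv_lt_top _ _
  filter_upwards [h2, h3] with x hx hlt
  rw [densMarginal, hx, ENNReal.toReal_sum fun y _ => (hlt y).ne]
  rfl

end Density

/-- Both arguments of the total variation distance are stable in `L¹`: since `f (· | x)` sums to
one, replacing the marginal costs at most as much as replacing the joint density, and the two
contributions cancel the factor `1 / 2`. -/
theorem abs_tvdOn_hybridJoint_sub_le [Fintype 𝒴]
    {X : Set (EuclideanSpace ℝ (Fin d))} (hX : MeasurableSet X)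
    {f : EuclideanSpace ℝ (Fin d) → 𝒴 → ℝ} (hf : IsCondPMFOn X f)
    (hfm : ∀ y, Measurable fun x : X => f x y)
    {a p : EuclideanSpace ℝ (Fin d) → 𝒴 → ℝ} {A q : EuclideanSpace ℝ (Fin d) → ℝ}
    (ha : ∀ y, Integrable (fun x => a x y)) (hp : ∀ y, Integrable (fun x => p x y))
    (hA : ∀ᵐ x, A x = ∑ y, a x y) (hq : ∀ᵐ x, q x = ∑ y, p x y) :
    |tvdOn X a (hybridJoint f A) - tvdOn X p (hybridJoint f q)| ≤
      ∑ y, ∫ x, |a x y - p x y| := by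
  have hAI : Integrable A := (integrable_finsetSum _ fun y _ => ha y).congr
    (hA.mono fun x hx => hx.symm)
  have hqI : Integrable q := (integrable_finsetSum _ fun y _ => hp y).congr
    (hq.mono fun x hx => hx.symm)
  have hf1 : ∀ y, ∀ᵐ x ∂(volume.restrict X), ‖f x y‖ ≤ 1 := fun y =>
    (ae_restrict_iff' hX).2 (ae_of_all _ fun x hx => by
      rw [Real.norm_of_nonneg (hf.nonneg x hx y), ← hf.sum_eq_one x hx]
      exact Finset.single_le_sum (fun y _ => hf.nonneg x hx y) (Finset.mem_univ y))
  have hfI : ∀ y {r : EuclideanSpace ℝ (Fin d) → ℝ}, Integrable r →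
      Integrable (fun x => f x y * r x) (volume.restrict X) := fun y r hr =>
    hr.integrableOn.bdd_mul
      (aemeasurable_restrict_of_measurable_subtype hX (hfm y)).aestronglyMeasurable (hf1 y)
  have hIa : ∀ y, Integrable (fun x => |a x y - f x y * A x|) (volume.restrict X) := fun y =>
    ((ha y).integrableOn.sub (hfI y hAI)).abs
  have hIp : ∀ y, Integrable (fun x => |p x y - f x y * q x|) (volume.restrict X) := fun y =>
    ((hp y).integrableOn.sub (hfI y hqI)).abs
  have hd : ∀ y, Integrable (fun x => |a x y - p x y|) := fun y => ((ha y).sub (hp y)).abs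
  have hAq : Integrable (fun x => |A x - q x|) := (hAI.sub hqI).abs
  have hterm : ∀ y, |(∫ x in X, |a x y - f x y * A x|) - (∫ x in X, |p x y - f x y * q x|)| ≤
      (∫ x in X, |a x y - p x y|) + ∫ x in X, f x y * |A x - q x| := by
    intro y
    rw [← integral_sub (hIa y) (hIp y), ← integral_add (hd y).integrableOn (hfI y hAq)]
    refine abs_integral_le_integral_abs.trans (setIntegral_mono_on ((hIa y).sub (hIp y)).abs
      ((hd y).integrableOn.add (hfI y hAq)) hX fun x hx => ?_)
    refine (abs_abs_sub_abs_le _ _).trans ?_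
    have : a x y - f x y * A x - (p x y - f x y * q x) =
        (a x y - p x y) - f x y * (A x - q x) := by ring
    rw [this]
    refine (abs_sub _ _).trans_eq ?_
    rw [abs_mul, abs_of_nonneg (hf.nonneg x hx y)]
  have hmarg : ∑ y, ∫ x in X, f x y * |A x - q x| ≤ ∑ y, ∫ x in X, |a x y - p x y| := by
    rw [← integral_finsetSum _ fun y _ => hfI y hAq,
      ← integral_finsetSum _ fun y _ => (hd y).integrableOn]
    refine integral_mono_ae (integrable_finsetSum _ fun y _ => hfI y hAq)
      (integrable_finsetSum _ fun y _ => (hd y).integrableOn) ?_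
    filter_upwards [ae_restrict_mem hX, ae_restrict_of_ae hA, ae_restrict_of_ae hq]
      with x hx h1 h2
    rw [← Finset.sum_mul, hf.sum_eq_one x hx, one_mul, h1, h2, ← Finset.sum_sub_distrib]
    exact Finset.abs_sum_le_sum_abs _ _
  have hset : ∑ y, ∫ x in X, |a x y - p x y| ≤ ∑ y, ∫ x, |a x y - p x y| :=
    Finset.sum_le_sum fun y _ =>
      setIntegral_le_integral (hd y) (ae_of_all _ fun x => abs_nonneg _)
  simp only [tvdOn, hybridJoint]
  rw [← mul_sub, ← Finset.sum_sub_distrib, abs_mul, abs_of_nonneg (by norm_num)]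
  have := (Finset.abs_sum_le_sum_abs (fun y => (∫ x in X, |a x y - f x y * A x|) -
    ∫ x in X, |p x y - f x y * q x|) Finset.univ).trans (Finset.sum_le_sum fun y _ => hterm y)
  rw [Finset.sum_add_distrib] at this
  linarith

variable [DecidableEq 𝒴] [MeasurableSpace 𝒴] [MeasurableSingletonClass 𝒴]
  {P : Measure (EuclideanSpace ℝ (Fin d) × 𝒴)} [IsProbabilityMeasure P]

variable {K : EuclideanSpace ℝ (Fin d) → ℝ}

theorem ae_tendsto_integral_abs_kdeJoint_sub_densJoint {Ω : Type*} [MeasurableSpace Ω]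
    {μ : Measure Ω} [IsProbabilityMeasure μ] {Z : ℕ → Ω → EuclideanSpace ℝ (Fin d) × 𝒴}
    (hZ : ∀ i, Measurable (Z i)) (hP : ∀ i, μ.map (Z i) = P) (hind : iIndepFun Z μ)
    (hac : P.map Prod.fst ≪ volume) (hK : Integrable K) (hK1 : ∫ x, K x = 1)
    {h : ℕ → ℝ} (hpos : ∀ n, 0 < h n) (hh : Tendsto h atTop (𝓝 0))
    (hnh : Tendsto (fun n : ℕ => (n : ℝ) * h n ^ d) atTop atTop) (y : 𝒴) :
    ∀ᵐ ω ∂μ, Tendsto (fun n => ∫ x, |kdeJoint K (h n) (fun i => Z i ω) n x y - densJoint P x y|)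
      atTop (𝓝 0) := by
  -- The estimator only depends on the almost everywhere class of `K` once it is integrated in `x`,
  -- so a measurable representative may be used.
  set K' := hK.aestronglyMeasurable.mk K with hK'
  have hKK' : K =ᵐ[volume] K' := hK.aestronglyMeasurable.ae_eq_mk
  have hs : MeasurableSet {z : EuclideanSpace ℝ (Fin d) × 𝒴 | z.2 = y} :=
    measurable_snd (measurableSet_singleton y)
  have hmain := ae_tendsto_integral_abs_kernelEstimate_sub (ν := volume) (ξ := Prod.fst)
    (w := fun z : EuclideanSpace ℝ (Fin d) × 𝒴 => if z.2 = y then 1 else 0) hZ hP hind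
    measurable_fst (measurable_const.ite hs measurable_const)
    (fun z => by split_ifs <;> simp)
    hK.aestronglyMeasurable.stronglyMeasurable_mk.measurable (hK.congr hKK')
    ((integral_congr_ae hKK').symm.trans hK1) (measurable_densJoint y) (integrable_densJoint y)
    (fun φ hφ => integral_indicator_mul_eq_integral_densJoint hac y hφ) hpos hh
    (by simpa using hnh)
  filter_upwards [hmain] with ω hω
  refine hω.congr fun n => integral_congr_ae ?_
  filter_upwards [kdeJoint_ae_congr hKK' (hpos n) (fun i => Z i ω) n y] with x hx
  rw [hx]
  simp only [kdeJoint, rescaledKernel, finrank_euclideanSpace_fin]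
  congr 4
  ext i
  ring

theorem ae_tendsto_tvdOn_kdeJoint [Fintype 𝒴] {Ω : Type*} [MeasurableSpace Ω]
    {μ : Measure Ω} [IsProbabilityMeasure μ] {Z : ℕ → Ω → EuclideanSpace ℝ (Fin d) × 𝒴}
    {X : Set (EuclideanSpace ℝ (Fin d))} (hX : MeasurableSet X)
    (hZ : ∀ i, Measurable (Z i)) (hP : ∀ i, μ.map (Z i) = P) (hind : iIndepFun Z μ)
    (hac : P.map Prod.fst ≪ volume)
    {f : EuclideanSpace ℝ (Fin d) → 𝒴 → ℝ} (hf : IsCondPMFOn X f)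
    (hfm : ∀ y, Measurable fun x : X => f x y)
    (hK : Integrable K) (hK1 : ∫ x, K x = 1)
    {h : ℕ → ℝ} (hpos : ∀ n, 1 ≤ n → 0 < h n) (hh : Tendsto h atTop (𝓝 0))
    (hnh : Tendsto (fun n : ℕ => (n : ℝ) * h n ^ d) atTop atTop) :
    ∀ᵐ ω ∂μ, Tendsto (fun n : ℕ => tvdOn X (kdeJoint K (h n) (fun i => Z i ω) n)
        (hybridJoint f (kdeMarginal K (h n) (fun i => Z i ω) n))) atTop
      (𝓝 (tvdOn X (densJoint P) (hybridJoint f (densMarginal P)))) := by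
  -- The bandwidth `h 0` may be nonpositive; it is irrelevant for the limit.
  set h' : ℕ → ℝ := fun n => if n = 0 then 1 else h n with hh'
  have heq : ∀ n, 1 ≤ n → h' n = h n := fun n hn => if_neg (by omega)
  have hev : h =ᶠ[atTop] h' := (eventually_ge_atTop 1).mono fun n hn => (heq n hn).symm
  have hpos' : ∀ n, 0 < h' n := by
    intro n
    rcases Nat.eq_zero_or_pos n with rfl | hn
    · simp [hh']
    · rw [heq n hn]; exact hpos n hn
  have hL1 : ∀ᵐ ω ∂μ, ∀ y, Tendsto
      (fun n => ∫ x, |kdeJoint K (h' n) (fun i => Z i ω) n x y - densJoint P x y|)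
      atTop (𝓝 0) :=
    ae_all_iff.2 fun y => ae_tendsto_integral_abs_kdeJoint_sub_densJoint hZ hP hind hac hK hK1
      hpos' (hh.congr' hev) (hnh.congr' (hev.mono fun n hn => by rw [hn])) y
  filter_upwards [hL1] with ω hω
  have hsum : Tendsto (fun n => ∑ y,
      ∫ x, |kdeJoint K (h' n) (fun i => Z i ω) n x y - densJoint P x y|) atTop (𝓝 0) := by
    simpa using tendsto_finsetSum Finset.univ fun y _ => hω y
  rw [tendsto_iff_dist_tendsto_zero]
  refine squeeze_zero' (Eventually.of_forall fun n => dist_nonneg) ?_ hsum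
  filter_upwards [hev] with n hn
  rw [hn, Real.dist_eq]
  exact abs_tvdOn_hybridJoint_sub_le hX hf hfm (integrable_kdeJoint hK (hpos' n) _ n)
    integrable_densJoint (ae_of_all _ fun x => rfl) (densMarginal_ae_eq_sum_densJoint hac)

end ContinuousCovariates

/-! ### Convergence of the total variation distances -/

theorem corollary1 {Ω : Type*} [MeasurableSpace Ω] (μ : Measure Ω) [IsProbabilityMeasure μ]
    {𝒴 : Type*} [Fintype 𝒴] [DecidableEq 𝒴] [MeasurableSpace 𝒴] [MeasurableSingletonClass 𝒴]
    {Θ : Type*} :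
    -- finite covariate space
    (∀ {𝒳 : Type*} [Fintype 𝒳] [DecidableEq 𝒳] [MeasurableSpace 𝒳] [MeasurableSingletonClass 𝒳]
        (P : Measure (𝒳 × 𝒴)) (Z : ℕ → Ω → 𝒳 × 𝒴)
        (f : Θ → 𝒳 → 𝒴 → ℝ),
        (∀ i, Measurable (Z i)) →
        (∀ i, μ.map (Z i) = P) →
        iIndepFun Z μ →
        (∀ θ, IsCondPMFOn Set.univ (f θ)) →
        ∀ θ, ∀ᵐ ω ∂μ,
          Tendsto
            (fun n : ℕ =>
              tvdFinite (empJoint (fun i => Z i ω) n)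
                (hybridJoint (f θ) (empMarginal (fun i => Z i ω) n)))
            atTop
            (𝓝 (tvdFinite (massJoint P) (hybridJoint (f θ) (massMarginal P))))) ∧
    -- continuous covariates, kernel-smoothed estimator
    (∀ {d : ℕ} (X : Set (EuclideanSpace ℝ (Fin d)))
        (P : Measure (EuclideanSpace ℝ (Fin d) × 𝒴))
        (Z : ℕ → Ω → EuclideanSpace ℝ (Fin d) × 𝒴)
        (f : Θ → EuclideanSpace ℝ (Fin d) → 𝒴 → ℝ)
        (K : EuclideanSpace ℝ (Fin d) → ℝ) (h : ℕ → ℝ),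
        MeasurableSet X →
        (∀ i, Measurable (Z i)) →
        (∀ i, μ.map (Z i) = P) →
        iIndepFun Z μ →
        (∀ᵐ x ∂(P.map Prod.fst), x ∈ X) →
        P.map Prod.fst ≪ volume →
        (∀ θ, IsCondPMFOn X (f θ)) →
        (∀ θ y, Measurable fun x : X => f θ x y) →
        Integrable K volume →
        ∫ x, K x = 1 →
        (∀ n, 1 ≤ n → 0 < h n) →
        Tendsto h atTop (𝓝 0) →
        Tendsto (fun n : ℕ => (n : ℝ) * h n ^ d) atTop atTop →
        ∀ θ, ∀ᵐ ω ∂μ,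
          Tendsto
            (fun n : ℕ =>
              tvdOn X (kdeJoint K (h n) (fun i => Z i ω) n)
                (hybridJoint (f θ) (kdeMarginal K (h n) (fun i => Z i ω) n)))
            (comap (fun n : ℕ => minOutcomeCount (fun i => Z i ω) n) atTop)
            (𝓝 (tvdOn X (densJoint P) (hybridJoint (f θ) (densMarginal P))))) := by
  refine ⟨?_, ?_⟩
  · intro 𝒳 _ _ _ _ P Z f hZ hP hind _ θ
    exact ae_tendsto_tvdFinite_empJoint hZ hP hind (f θ)
  · intro d X P Z f K h hX hZ hP hind _ hac hf hfm hK hK1 hpos hh hnh θ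
    have : IsProbabilityMeasure P := hP 0 ▸ Measure.isProbabilityMeasure_map (hZ 0).aemeasurable
    filter_upwards [ae_tendsto_tvdOn_kdeJoint hX hZ hP hind hac (hf θ) (hfm θ) hK hK1 hpos hh hnh]
      with ω hω
    -- `minOutcomeCount ≤ n`, so the limit along large counts is implied by the limit in `n`.
    have : Nonempty 𝒴 := ⟨(Z 0 ω).2⟩
    exact hω.mono_left (comap_minOutcomeCount_atTop_le _)
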